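/- All Hilbert spaces are finite-dimensional, all alphabets are finite, and $\log$ is to base $2$. Let $x\mapsto\rho_x^{BC}$ ($x\in\mathcal X$) be a classical-quantum broadcast channel, i.e. each $\rho_x^{BC}$ is a density matrix on $\mathcal H_B\otimes\mathcal H_C$. Let $(U,V)\sim p_{UV}$ be a pair of random variables with values in $\mathcal U\times\mathcal V$, let $f:\mathcal U\times\mathcal V\to\mathcal X$, and put $$\rho^{UVBC}=\sum_{(u,v)}p_{UV}(u,v)\,|u\rangle\langle u|^U\otimes|v\rangle\langle v|^V\otimes\rho^{BC}_{f(u,v)},$$ with reduced states $\rho^{UB}$, $\rho^{VC}$, etc. For $\delta\in[0,1)$ and a state $\rho^{UB}$ define $$I_0^{\delta}[U;B]=\sup\{-\log\mathrm{Tr}[\Gamma(\rho^U\otimes\rho^B)] : 0\preceq\Gamma\preceq\mathbb I,\ \mathrm{Tr}[\Gamma\rho^{UB}]>1-\delta\},$$ similarly $I_0^\delta[V;C]$ from $\rho^{VC}$, and $$I_\infty^{\delta}[U;V]=\inf_{\mathcal G\subseteq\mathcal U\times\mathcal V,\ p_{UV}(\mathcal G)>1-\delta}\ \sup_{(u,v)\in\mathcal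 G}\log\frac{p_{UV}(u,v)}{p_U(u)p_V(v)},$$ with values in $[-\infty,+\infty]$ ($\sup\emptyset=-\infty$, $\inf\emptyset=+\infty$; a pair with $p_{UV}(u,v)=0$ contributes $-\infty$ to the inner supremum). For $R_1,R_2\ge 0$ let $[2^{R}]=\{1,\dots,\lfloor 2^{R}\rfloor\}$. An $(R_1,R_2,\varepsilon)$ classical-quantum broadcast code consists of an encoding function $F:[2^{R_1}]\times[2^{R_2}]\to\mathcal X$ and POVMs $\{\mathcal T^B_{m_1}\}_{m_1\in[2^{R_1}]}$ on $\mathcal H_B$ and $\{\mathcal T^C_{m_2}\}_{m_2\in[2^{R_2}]}$ on $\mathcal H_C$ such that the average, over all message pairs $(m_1,m_2)\in[2^{R_1}]\times[2^{R_2}]$, of $$\mathrm{Tr}\big[(\mathbb I-\mathcal T^B_{m_1}\otimes\mathcal T^C_{m_2})\,\rho^{BC}_{F(m_1,m_2)}\big]$$ is at most $\varepsilon$. Theorem. Let $R_1,R_2\ge0$, $\varepsilon\in\mathbb R$, $0\le\varepsilon_0<1$, $0\le\varepsilon_\infty\le\frac14$ and $\tilde\varepsilon>0$ satisfy $40\tilde\varepsilon+16\varepsilon_0\le\varepsilon$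 and $$R_1\le I_0^{\varepsilon_0}[U;B]-5\log\tfrac1{\tilde\varepsilon}-2,\qquad R_2\le I_0^{\varepsilon_0}[V;C]-5\log\tfrac1{\tilde\varepsilon}-2,$$ $$R_1+R_2\le I_0^{\varepsilon_0}[U;B]+I_0^{\varepsilon_0}[V;C]-I_\infty^{\varepsilon_\infty}[U;V]-11\log\tfrac1{\tilde\varepsilon}-5.$$ Then there exists an $(R_1,R_2,\varepsilon)$ classical-quantum broadcast code for the channel. -/

import Mathlib

open scoped Kronecker ComplexOrder BigOperators

noncomputable section

namespace CQBroadcast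

/-! ## Density matrices, POVMs, partial traces

A finite-dimensional Hilbert space is `ℂ^n` with `n` a finite index type, and the tensor product of
two such spaces is indexed by the product type. -/

/-- A density matrix: positive semidefinite with trace one. -/
structure IsDensityMatrix {n : Type*} [Fintype n] (ρ : Matrix n n ℂ) : Prop where
  posSemidef : ρ.PosSemidef
  trace_eq_one : ρ.trace = 1

/-- A POVM with finite outcome set `M`. -/
structure IsPOVM {M n : Type*} [Fintype M] [Fintype n] [DecidableEq n]
    (T : M → Matrix n n ℂ) : Prop where
  posSemidef : ∀ m, (T m).PosSemidef
  sum_eq_one : ∑ m, T m = 1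

/-- Partial trace over the second tensor factor. -/
def traceRight {m n : Type*} [Fintype n] (ρ : Matrix (m × n) (m × n) ℂ) : Matrix m m ℂ :=
  fun i j => ∑ k, ρ (i, k) (j, k)

/-- Partial trace over the first tensor factor. -/
def traceLeft {m n : Type*} [Fintype m] (ρ : Matrix (m × n) (m × n) ℂ) : Matrix n n ℂ :=
  fun i j => ∑ k, ρ (k, i) (k, j)

/-! ## Smooth Rényi quantities -/

/-- Base-two logarithm of a nonnegative real number as an extended real, with `log 0 = -∞`. -/
def elog (x : ℝ) : EReal := if 0 < x then ((Real.logb 2 x : ℝ) : EReal) else ⊥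

/-- The tests `0 ⪯ Γ ⪯ 1` with `Tr (Γ ρ) > 1 - ε`. -/
def tests {n : Type*} [Fintype n] [DecidableEq n] (ε : ℝ) (ρ : Matrix n n ℂ) :
    Set (Matrix n n ℂ) :=
  {Γ | Γ.PosSemidef ∧ (1 - Γ).PosSemidef ∧ 1 - ε < (Γ * ρ).trace.re}

/-- Smooth min Rényi divergence `I₀^ε[A;B]` of a bipartite state `ρ = ρ^{AB}`: the supremum of
`- log Tr (Γ (ρ^A ⊗ ρ^B))` over the tests `Γ`. -/
def smoothMin {m n : Type*} [Fintype m] [Fintype n] [DecidableEq m] [DecidableEq n]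
    (ε : ℝ) (ρ : Matrix (m × n) (m × n) ℂ) : EReal :=
  ⨆ Γ ∈ tests ε ρ, - elog ((Γ * (traceRight ρ ⊗ₖ traceLeft ρ)).trace.re)

/-- First marginal of a joint probability mass function. -/
def marginalFst {𝒰 𝒱 : Type*} [Fintype 𝒱] (p : 𝒰 × 𝒱 → ℝ) (u : 𝒰) : ℝ := ∑ v, p (u, v)

/-- Second marginal of a joint probability mass function. -/
def marginalSnd {𝒰 𝒱 : Type*} [Fintype 𝒰] (p : 𝒰 × 𝒱 → ℝ) (v : 𝒱) : ℝ := ∑ u, p (u, v)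

/-- Smooth max Rényi divergence `I_∞^ε[U;V]` of a pair of random variables with joint probability
mass function `p`: the infimum over all sets `G` of probability more than `1 - ε` of the supremum
over `G` of `log (p(u,v) / (p(u) p(v)))`. -/
def smoothMax {𝒰 𝒱 : Type*} [Fintype 𝒰] [Fintype 𝒱] (ε : ℝ) (p : 𝒰 × 𝒱 → ℝ) : EReal :=
  ⨅ G ∈ {G : Finset (𝒰 × 𝒱) | 1 - ε < ∑ w ∈ G, p w},
    ⨆ w ∈ G, elog (p w / (marginalFst p w.1 * marginalSnd p w.2))

/-! ## Channels and codes -/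

/-- A classical-quantum broadcast channel `x ↦ ρ_x^{BC}`. -/
structure Channel (𝒳 b c : Type*) [Fintype b] [Fintype c] where
  state : 𝒳 → Matrix (b × c) (b × c) ℂ
  isDensityMatrix : ∀ x, IsDensityMatrix (state x)

/-- The set `[2^R]` has this many elements. -/
def numMessages (R : ℝ) : ℕ := ⌊(2 : ℝ) ^ R⌋₊

/-- An `(R₁, R₂, ε)` classical-quantum broadcast channel code. -/
structure Code {𝒳 b c : Type*} [Fintype b] [Fintype c] [DecidableEq b] [DecidableEq c]
    (N : Channel 𝒳 b c) (R₁ R₂ ε : ℝ) where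
  encode : Fin (numMessages R₁) × Fin (numMessages R₂) → 𝒳
  decB : Fin (numMessages R₁) → Matrix b b ℂ
  decC : Fin (numMessages R₂) → Matrix c c ℂ
  isPOVM_decB : IsPOVM decB
  isPOVM_decC : IsPOVM decC
  average_error_le :
    (∑ m : Fin (numMessages R₁) × Fin (numMessages R₂),
        (((1 - decB m.1 ⊗ₖ decC m.2) * N.state (encode m)).trace).re)
      / ((numMessages R₁ : ℝ) * (numMessages R₂ : ℝ)) ≤ ε

/-! ## The state defined by the auxiliary variables -/

/-- `ρ^{UVBC} = ∑ p(u,v) |u⟩⟨u| ⊗ |v⟩⟨v| ⊗ ρ^{BC}_{f(u,v)}`. -/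
def stateUVBC {𝒳 𝒰 𝒱 b c : Type*} [Fintype 𝒰] [Fintype 𝒱] [Fintype b] [Fintype c]
    [DecidableEq 𝒰] [DecidableEq 𝒱]
    (N : Channel 𝒳 b c) (p : 𝒰 × 𝒱 → ℝ) (f : 𝒰 × 𝒱 → 𝒳) :
    Matrix (𝒰 × 𝒱 × b × c) (𝒰 × 𝒱 × b × c) ℂ :=
  ∑ w : 𝒰 × 𝒱, (p w : ℂ) •
    (Matrix.single w.1 w.1 (1 : ℂ) ⊗ₖ (Matrix.single w.2 w.2 (1 : ℂ) ⊗ₖ N.state (f w)))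

/-- `ρ^{UB}`, the partial trace over `V` and `C`. -/
def marginalUB {𝒰 𝒱 b c : Type*} [Fintype 𝒱] [Fintype c]
    (ρ : Matrix (𝒰 × 𝒱 × b × c) (𝒰 × 𝒱 × b × c) ℂ) : Matrix (𝒰 × b) (𝒰 × b) ℂ :=
  fun i j => ∑ v, ∑ z, ρ (i.1, v, i.2, z) (j.1, v, j.2, z)

/-- `ρ^{VC}`, the partial trace over `U` and `B`. -/
def marginalVC {𝒰 𝒱 b c : Type*} [Fintype 𝒰] [Fintype b]
    (ρ : Matrix (𝒰 × 𝒱 × b × c) (𝒰 × 𝒱 × b × c) ℂ) : Matrix (𝒱 × c) (𝒱 × c) ℂ :=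
  fun i j => ∑ u, ∑ y, ρ (u, i.1, y, i.2) (u, j.1, y, j.2)

end CQBroadcast

end

/-!
The code is a random code, and the two receivers are treated separately: since
`1 - P ⊗ Q ≤ (1 - P) ⊗ 1 + 1 ⊗ (1 - Q)` for effects `P`, `Q`, the error is at most the error of the
decoder at `B` plus that of the decoder at `C` (`trace_one_sub_kronecker_mul_le`).

*Codebook.* For each message `m₁` draw a bin of `K` symbols from `p_U`, for each `m₂` a bin of `L`
symbols from `p_V`, all independent. For a message pair the encoder picks the pair of bin indices
whose error is least. Give `(u, v)` the weight `w(u, v) = p(u, v) / (p(u) p(v))`, restricted to a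
set `G` on which this ratio is at most `2 ^ s`, with `s` slightly larger than the smooth max
divergence. The least error is at most the `w`-weighted mean of the errors, and the total weight of
a pair of bins has mean `K L p(G)`. Its variance is at most `K L p(G) (K + L + 2 ^ s)`
(`iidMean_variance_le`), so it concentrates once `K`, `L` and `K L / 2 ^ s` are large; this is the
mutual covering lemma in the form of a second moment bound. Weighting by `w` changes the law
`p_U p_V` of a pair of codewords into `p` restricted to `G`, and leaves the other codewords
independent of that pair (`exists_codebook`).

*Decoders.* The tests that nearly attain the smooth min divergences are cut into their diagonal
blocks `Γ_u` (resp. `Λ_v`), and the decoder is the square-root measurement built from the blocks of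
the codebook, regularised by `δ • 1` to make the normalising matrix invertible. The
Hayashi-Nagaoka inequality (`hayashi_nagaoka`) bounds its error by twice the failure probability of
the right test plus four times the false alarms of the others. After averaging, and up to a
factor `2 / p(G)` from the weights, the former is at most `2 ε₀` and each of the latter at most
`4 * 2 ^ (-I)` for `I` slightly smaller than the smooth min divergence.

*Constants.* It remains to choose `K` and `L` about as large as the false alarms allow
(`exists_bin_sizes`): the individual rate constraints make both of them large, and the constraint on
the sum of the rates makes `K L / 2 ^ s` large.
-/

namespace CQBroadcast

open scoped MatrixOrder

/-! ### The Hayashi-Nagaoka inequality and the square-root measurement -/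

section PrettyGood

variable {n : Type*} [Fintype n] [DecidableEq n]

open scoped Matrix.Norms.L2Operator in
/-- For an effect `S` one has `S ^ 2 ≤ S ≤ Y`, and the square root is operator monotone. -/
theorem le_sqrt_of_le {S Y : Matrix n n ℂ} (hS : 0 ≤ S) (hS1 : S ≤ 1) (hSY : S ≤ Y) :
    S ≤ CFC.sqrt Y := by
  have h : S * S ≤ S := by
    have h1 : 0 ≤ S - S * S := by
      have e : S - S * S = S * (1 - S) * star S + (1 - S) * S * star (1 - S) := by
        have hSs : star S = S := (Matrix.nonneg_iff_posSemidef.1 hS).isHermitian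
        rw [hSs, star_sub, star_one, hSs]
        noncomm_ring
      rw [e]
      exact add_nonneg (star_right_conjugate_nonneg (sub_nonneg.2 hS1) S)
        (star_right_conjugate_nonneg hS (1 - S))
    exact sub_nonneg.1 h1
  have h2 := CFC.sqrt_le_sqrt _ _ (h.trans hSY)
  rwa [CFC.sqrt_mul_self S hS] at h2

/-- The Hayashi-Nagaoka inequality, for `S + T` invertible. With `R = √(S + T)` and `X = R⁻¹`, the
difference of the two sides is `(X - 2) T (X - 2) + 2 (X - 1) S (X - 1) + 4 (R - S)`, a sum of
positive terms. -/
theorem hayashi_nagaoka {S T : Matrix n n ℂ} (hS : 0 ≤ S) (hS1 : S ≤ 1) (hT : 0 ≤ T)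
    (hu : IsUnit (S + T)) :
    1 - (CFC.sqrt (S + T))⁻¹ * S * (CFC.sqrt (S + T))⁻¹ ≤ 2 • (1 - S) + 4 • T := by
  have hY : 0 ≤ S + T := add_nonneg hS hT
  have hle : S ≤ CFC.sqrt (S + T) := le_sqrt_of_le hS hS1 (le_add_of_nonneg_right hT)
  have hRR : CFC.sqrt (S + T) * CFC.sqrt (S + T) = S + T := CFC.sqrt_mul_sqrt_self _ hY
  have hR0 : 0 ≤ CFC.sqrt (S + T) := CFC.sqrt_nonneg _
  have hRu : IsUnit (CFC.sqrt (S + T)) := by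
    rw [Matrix.isUnit_iff_isUnit_det] at hu ⊢
    rw [← hRR, Matrix.det_mul] at hu
    exact isUnit_of_mul_isUnit_left hu
  generalize CFC.sqrt (S + T) = R at *
  have hXR : R⁻¹ * R = 1 := Matrix.nonsing_inv_mul R ((Matrix.isUnit_iff_isUnit_det R).1 hRu)
  have hRX : R * R⁻¹ = 1 := Matrix.mul_nonsing_inv R ((Matrix.isUnit_iff_isUnit_det R).1 hRu)
  have hXs : star R⁻¹ = R⁻¹ :=
    ((Matrix.nonneg_iff_posSemidef.1 hR0).isHermitian.inv).isSelfAdjoint.star_eq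
  generalize R⁻¹ = X at *
  -- the three summands of the difference are positive
  have h1 : 0 ≤ (X - 2) * T * (X - 2) := by
    have := star_right_conjugate_nonneg hT (X - 2)
    rwa [star_sub, hXs, star_ofNat] at this
  have h2 : 0 ≤ (X - 1) * S * (X - 1) := by
    have := star_right_conjugate_nonneg hS (X - 1)
    rwa [star_sub, hXs, star_one] at this
  have hT' : T = R * R - S := by rw [hRR]; abel
  have hXRR : X * (R * R) * X = 1 := by
    rw [← mul_assoc, hXR, one_mul, hRX]
  have key : 2 • (1 - S) + 4 • T - (1 - X * S * X)
      = (X - 2) * T * (X - 2) + 2 • ((X - 1) * S * (X - 1)) + 4 • (R - S) := by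
    have e1 : X * T * X = 1 - X * S * X := by rw [hT', mul_sub, sub_mul, hXRR]
    have e2 : X * S = R - X * T := by
      rw [hT', mul_sub, ← mul_assoc, hXR, one_mul]; abel
    have e3 : S * X = R - T * X := by
      rw [hT', sub_mul, mul_assoc, hRX, mul_one]; abel
    have e4 : (X - 2) * T * (X - 2) = X * T * X - 2 • (X * T) - 2 • (T * X) + 4 • T := by
      noncomm_ring
    have e5 : (X - 1) * S * (X - 1) = X * S * X - X * S - S * X + S := by
      noncomm_ring
    rw [e4, e5, e1, e2, e3]
    have e6 : (R - X * T) * X = 1 - X * T * X := by rw [sub_mul, hRX]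
    rw [e6]
    abel
  rw [← sub_nonneg, key]
  exact add_nonneg (add_nonneg h1 (nsmul_nonneg h2 2)) (nsmul_nonneg (sub_nonneg.2 hle) 4)

/-- The square-root measurement of a family of effects, several of which (indexed by `κ`) may stand
for the same outcome in `M`. The term `δ • 1` makes the normalising matrix invertible; the part of
the identity it accounts for is added to an arbitrary outcome. -/
theorem exists_povm_hayashi_nagaoka {M κ : Type*} [Fintype M] [Fintype κ] [Nonempty M]
    [DecidableEq M] [DecidableEq κ] (Γ : M × κ → Matrix n n ℂ) (h0 : ∀ i, 0 ≤ Γ i)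
    (h1 : ∀ i, Γ i ≤ 1) {δ : ℝ} (hδ : 0 < δ) :
    ∃ T : M → Matrix n n ℂ, IsPOVM T ∧ ∀ i : M × κ,
      1 - T i.1 ≤ 2 • (1 - Γ i) + 4 • (∑ j ∈ Finset.univ.erase i, Γ j + (δ : ℂ) • 1) := by
  have hδ1 : Matrix.PosDef ((δ : ℂ) • (1 : Matrix n n ℂ)) :=
    Matrix.PosDef.one.smul (by exact_mod_cast hδ)
  have hδ0 : 0 ≤ ((δ : ℂ) • (1 : Matrix n n ℂ)) := Matrix.nonneg_iff_posSemidef.2 hδ1.posSemidef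
  set Y : Matrix n n ℂ := ∑ i, Γ i + (δ : ℂ) • 1 with hYdef
  have hsum : 0 ≤ ∑ i, Γ i := Finset.sum_nonneg fun i _ => h0 i
  have hY0 : 0 ≤ Y := add_nonneg hsum hδ0
  have hYu : IsUnit Y := (Matrix.PosDef.posSemidef_add
    (Matrix.nonneg_iff_posSemidef.1 hsum) hδ1).isUnit
  set X : Matrix n n ℂ := (CFC.sqrt Y)⁻¹ with hX
  have hR0 : 0 ≤ CFC.sqrt Y := CFC.sqrt_nonneg _
  have hXs : star X = X :=
    ((Matrix.nonneg_iff_posSemidef.1 hR0).isHermitian.inv).isSelfAdjoint.star_eq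
  have hconj : ∀ A : Matrix n n ℂ, 0 ≤ A → 0 ≤ X * A * X := fun A hA => by
    have := star_right_conjugate_nonneg hA X
    rwa [hXs] at this
  have hXYX : X * Y * X = 1 := by
    have hRR : CFC.sqrt Y * CFC.sqrt Y = Y := CFC.sqrt_mul_sqrt_self _ hY0
    have hRu : IsUnit (CFC.sqrt Y).det := by
      rw [Matrix.isUnit_iff_isUnit_det, ← hRR, Matrix.det_mul] at hYu
      exact isUnit_of_mul_isUnit_left hYu
    calc X * Y * X = X * (CFC.sqrt Y * CFC.sqrt Y) * X := by rw [hRR]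
      _ = 1 := by
        rw [← mul_assoc, hX, Matrix.nonsing_inv_mul _ hRu, one_mul, Matrix.mul_nonsing_inv _ hRu]
  let m₀ : M := Classical.arbitrary M
  let rest : Matrix n n ℂ := X * ((δ : ℂ) • 1) * X
  have hrest : 0 ≤ rest := hconj _ hδ0
  let D : M → Matrix n n ℂ := fun m => X * (∑ k, Γ (m, k)) * X
  have hD : ∀ m, 0 ≤ D m := fun m => hconj _ (Finset.sum_nonneg fun k _ => h0 _)
  have hite : ∀ m, 0 ≤ if m = m₀ then rest else 0 := fun m => by
    split_ifs
    exacts [hrest, le_rfl]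
  refine ⟨fun m => D m + if m = m₀ then rest else 0, ⟨fun m => ?_, ?_⟩, fun i => ?_⟩
  · exact Matrix.nonneg_iff_posSemidef.1 (add_nonneg (hD m) (hite m))
  · rw [Finset.sum_add_distrib, Finset.sum_ite_eq' Finset.univ m₀ (fun _ => rest),
      if_pos (Finset.mem_univ _), ← hXYX, hYdef, Fintype.sum_prod_type, mul_add, add_mul,
      Finset.mul_sum, Finset.sum_mul]
  · have hS : Γ i + (∑ j ∈ Finset.univ.erase i, Γ j + (δ : ℂ) • 1) = Y := by
      rw [← add_assoc, Finset.add_sum_erase _ _ (Finset.mem_univ i)]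
    have hT : 0 ≤ ∑ j ∈ Finset.univ.erase i, Γ j + (δ : ℂ) • 1 :=
      add_nonneg (Finset.sum_nonneg fun j _ => h0 j) hδ0
    have key := hayashi_nagaoka (h0 i) (h1 i) hT (by rw [hS]; exact hYu)
    rw [hS] at key
    refine le_trans (sub_le_sub_left ?_ 1) key
    have : X * Γ i * X ≤ D i.1 := by
      have hle : 0 ≤ ∑ k, Γ (i.1, k) - Γ i := sub_nonneg.2
        (Finset.single_le_sum (f := fun k => Γ (i.1, k)) (fun k _ => h0 _) (Finset.mem_univ i.2))
      have := hconj _ hle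
      rw [mul_sub, sub_mul] at this
      exact sub_nonneg.1 this
    exact this.trans (le_add_of_nonneg_right (hite i.1))

end PrettyGood

/-! ### Means over random codebooks -/

section IidMean

variable {ι α : Type*} [Fintype ι] [DecidableEq ι] [Fintype α]

/-- The mean of `φ (u)` over a codebook `u : ι → α` with independent entries of law `q`. -/
noncomputable def iidMean (q : α → ℝ) (φ : (ι → α) → ℝ) : ℝ :=
  ∑ u : ι → α, (∏ i, q (u i)) * φ u

variable {q : α → ℝ}

theorem iidMean_add (φ ψ : (ι → α) → ℝ) :
    iidMean q (fun u => φ u + ψ u) = iidMean q φ + iidMean q ψ := by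
  simp only [iidMean, mul_add, Finset.sum_add_distrib]

theorem iidMean_const_mul (c : ℝ) (φ : (ι → α) → ℝ) :
    iidMean q (fun u => c * φ u) = c * iidMean q φ := by
  simp only [iidMean, Finset.mul_sum, mul_left_comm]

theorem iidMean_sum {κ : Type*} (s : Finset κ) (φ : κ → (ι → α) → ℝ) :
    iidMean q (fun u => ∑ k ∈ s, φ k u) = ∑ k ∈ s, iidMean q (φ k) := by
  simp only [iidMean, Finset.mul_sum]
  exact Finset.sum_comm

theorem iidMean_mono (hq : ∀ a, 0 ≤ q a) {φ ψ : (ι → α) → ℝ} (h : ∀ u, φ u ≤ ψ u) :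
    iidMean q φ ≤ iidMean q ψ :=
  Finset.sum_le_sum fun u _ =>
    mul_le_mul_of_nonneg_left (h u) (Finset.prod_nonneg fun _ _ => hq _)

theorem iidMean_prod (h : ι → α → ℝ) :
    iidMean q (fun u => ∏ i, h i (u i)) = ∏ i, ∑ a, q a * h i a := by
  classical
  simp only [iidMean, ← Finset.prod_mul_distrib]
  rw [Finset.prod_univ_sum, Fintype.piFinset_univ]

theorem iidMean_const (hq1 : ∑ a, q a = 1) (c : ℝ) :
    iidMean q (fun _ : ι → α => c) = c := by
  have h := iidMean_prod (q := q) (fun (_ : ι) (_ : α) => (1 : ℝ))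
  simp only [Finset.prod_const_one, mul_one, hq1] at h
  have := iidMean_const_mul (q := q) c (fun _ : ι → α => (1 : ℝ))
  simpa [h] using this

theorem iidMean_eval (hq1 : ∑ a, q a = 1) (i : ι) (φ : α → ℝ) :
    iidMean q (fun u => φ (u i)) = ∑ a, q a * φ a := by
  have h := iidMean_prod (q := q) (fun (k : ι) (a : α) => if k = i then φ a else 1)
  simpa [apply_ite, Finset.prod_ite_eq', hq1, Finset.sum_ite_irrel] using h

theorem iidMean_eval_mul_eval (hq1 : ∑ a, q a = 1) {i j : ι} (hij : i ≠ j) (φ ψ : α → ℝ) :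
    iidMean q (fun u => φ (u i) * ψ (u j)) = (∑ a, q a * φ a) * ∑ a, q a * ψ a := by
  have h := iidMean_prod (q := q)
    (fun (k : ι) (a : α) => (if k = i then φ a else 1) * (if k = j then ψ a else 1))
  have e : ∀ k, ∑ a, q a * ((if k = i then φ a else 1) * (if k = j then ψ a else 1))
      = (if k = i then ∑ a, q a * φ a else 1) * (if k = j then ∑ a, q a * ψ a else 1) := by
    intro k
    rcases eq_or_ne k i with rfl | hk
    · simp [hij]
    · rcases eq_or_ne k j with rfl | hk'
      · simp [hk]
      · simp [hk, hk', hq1]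
  simp only [e] at h
  simpa only [Finset.prod_mul_distrib, Finset.prod_ite_eq', Finset.mem_univ, if_true] using h

theorem iidMean_eval₂ (hq1 : ∑ a, q a = 1) {i j : ι} (hij : i ≠ j) (φ : α → α → ℝ) :
    iidMean q (fun u => φ (u i) (u j)) = ∑ a, q a * ∑ b, q b * φ a b := by
  classical
  have e : ∀ u : ι → α, φ (u i) (u j) = ∑ a, (if u i = a then 1 else 0) * φ a (u j) := by
    simp
  simp only [e]
  rw [iidMean_sum]
  refine Finset.sum_congr rfl fun a _ => ?_
  rw [iidMean_eval_mul_eval hq1 hij (fun x => if x = a then 1 else 0) (φ a)]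
  simp

theorem iidMean_comm {κ β : Type*} [Fintype κ] [DecidableEq κ] [Fintype β] {r : β → ℝ}
    (F : (ι → α) → (κ → β) → ℝ) :
    iidMean q (fun u => iidMean r (fun v => F u v))
      = iidMean r (fun v => iidMean q (fun u => F u v)) := by
  simp only [iidMean, Finset.mul_sum]
  rw [Finset.sum_comm]
  simp only [mul_left_comm]

theorem exists_le_iidMean (hq : ∀ a, 0 ≤ q a) (hq1 : ∑ a, q a = 1) (φ : (ι → α) → ℝ) :
    ∃ u, φ u ≤ iidMean q φ := by
  by_contra! hlt
  have hone : ∑ u : ι → α, ∏ i, q (u i) = 1 := by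
    simpa [iidMean] using iidMean_const (ι := ι) hq1 1
  obtain ⟨u, -, hu⟩ : ∃ u ∈ Finset.univ, 0 < ∏ i, q ((u : ι → α) i) := by
    by_contra! hle
    have := Finset.sum_nonpos hle
    linarith
  have : iidMean q (fun _ : ι → α => iidMean q φ) < iidMean q φ :=
    Finset.sum_lt_sum (fun v _ => mul_le_mul_of_nonneg_left (hlt v).le
      (Finset.prod_nonneg fun _ _ => hq _))
      ⟨u, Finset.mem_univ u, mul_lt_mul_of_pos_left (hlt u) hu⟩
  rw [iidMean_const hq1] at this
  exact lt_irrefl _ this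

end IidMean

/-- The least of the errors `e i ∈ [0, 1]` is at most twice their `w`-weighted sum over the expected
total weight `μ`, up to a Chebyshev term: either the total weight is at least `μ / 2`, or it misses
`μ` by so much that the last term is at least `1`. -/
theorem exists_le_weighted_mean {ι : Type*} [Fintype ι] [Nonempty ι] {w e : ι → ℝ} {μ : ℝ}
    (hμ : 0 < μ) (hw : ∀ i, 0 ≤ w i) (he : ∀ i, 0 ≤ e i) (he1 : ∀ i, e i ≤ 1) :
    ∃ i, e i ≤ 2 / μ * ∑ i, w i * e i + 4 / μ ^ 2 * (∑ i, w i - μ) ^ 2 := by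
  obtain ⟨i, hi⟩ := Finite.exists_min e
  refine ⟨i, ?_⟩
  have hsum : (∑ j, w j) * e i ≤ ∑ j, w j * e j := by
    rw [Finset.sum_mul]
    exact Finset.sum_le_sum fun j _ => mul_le_mul_of_nonneg_left (hi j) (hw j)
  have hwe : 0 ≤ ∑ j, w j * e j := Finset.sum_nonneg fun j _ => mul_nonneg (hw j) (he j)
  rcases le_or_gt (μ / 2) (∑ j, w j) with h | h
  · have h1 : μ / 2 * e i ≤ ∑ j, w j * e j := (mul_le_mul_of_nonneg_right h (he i)).trans hsum
    have h2 : e i ≤ 2 / μ * ∑ j, w j * e j := by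
      rw [div_mul_eq_mul_div, le_div_iff₀ hμ]
      linarith
    have : 0 ≤ 4 / μ ^ 2 * (∑ i, w i - μ) ^ 2 := by positivity
    linarith
  · have h1 : (μ / 2) ^ 2 ≤ (∑ i, w i - μ) ^ 2 := by
      rw [← neg_sq (∑ i, w i - μ)]
      exact pow_le_pow_left₀ (by positivity) (by linarith) 2
    have h2 : 1 ≤ 4 / μ ^ 2 * (∑ i, w i - μ) ^ 2 := by
      rw [div_mul_eq_mul_div, le_div_iff₀ (by positivity)]
      linarith
    have : 0 ≤ 2 / μ * ∑ i, w i * e i := by positivity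
    linarith [he1 i]

/-! ### Mutual covering -/

section MutualCovering

variable {α β ι κ : Type*} [Fintype α] [Fintype β] [Fintype ι] [Fintype κ] [DecidableEq ι]
  [DecidableEq κ] {q : α → ℝ} {r : β → ℝ} {w : α → β → ℝ} {W : ℝ}

/-- Weights of two pairs of codewords that share exactly one codeword are conditionally independent
given that codeword. -/
theorem iidMean_weight_mul_weight_of_ne_le (hq : ∀ a, 0 ≤ q a) (hq1 : ∑ a, q a = 1)
    (hr1 : ∑ b, r b = 1) (hr : ∀ b, 0 ≤ r b) (hw : ∀ a b, 0 ≤ w a b)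
    (hs : ∀ a, ∑ b, r b * w a b ≤ 1) (i : ι) {j j' : κ} (hj : j ≠ j') :
    iidMean q (fun u : ι → α => iidMean r (fun v : κ → β => w (u i) (v j) * w (u i) (v j')))
      ≤ ∑ a, q a * ∑ b, r b * w a b := by
  simp only [iidMean_eval_mul_eval hr1 hj]
  rw [iidMean_eval hq1 i (fun a => (∑ b, r b * w a b) * ∑ b, r b * w a b)]
  refine Finset.sum_le_sum fun a _ => mul_le_mul_of_nonneg_left ?_ (hq a)
  exact mul_le_of_le_one_left (Finset.sum_nonneg fun b _ => mul_nonneg (hr b) (hw a b)) (hs a)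

/-- The correlation of the weights of two pairs of codewords, according to which codewords they
share. -/
theorem iidMean_weight_mul_weight_le (hq : ∀ a, 0 ≤ q a) (hq1 : ∑ a, q a = 1)
    (hr : ∀ b, 0 ≤ r b) (hr1 : ∑ b, r b = 1) (hw : ∀ a b, 0 ≤ w a b) (hW : ∀ a b, w a b ≤ W)
    (hs : ∀ a, ∑ b, r b * w a b ≤ 1) (ht : ∀ b, ∑ a, q a * w a b ≤ 1) {g : ℝ}
    (hg : ∑ a, q a * ∑ b, r b * w a b = g) (i i' : ι) (j j' : κ) :
    iidMean q (fun u : ι → α => iidMean r (fun v : κ → β => w (u i) (v j) * w (u i') (v j')))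
      ≤ g ^ 2 + (if i = i' then g else 0) + (if j = j' then g else 0)
        + (if i = i' then if j = j' then W * g else 0 else 0) := by
  have hg0 : 0 ≤ g := by
    rw [← hg]
    exact Finset.sum_nonneg fun a _ => mul_nonneg (hq a)
      (Finset.sum_nonneg fun b _ => mul_nonneg (hr b) (hw a b))
  have hg' : ∑ b, r b * ∑ a, q a * w a b = g := by
    rw [← hg]
    simp only [Finset.mul_sum]
    rw [Finset.sum_comm]
    simp only [mul_left_comm]
  rcases eq_or_ne i i' with rfl | hi <;> rcases eq_or_ne j j' with rfl | hj
  · simp only [if_true]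
    have : iidMean q (fun u : ι → α => iidMean r (fun v : κ → β => w (u i) (v j) * w (u i) (v j)))
        ≤ W * g := by
      have e : ∀ u : ι → α, iidMean r (fun v : κ → β => w (u i) (v j) * w (u i) (v j))
          = ∑ b, r b * (w (u i) b * w (u i) b) :=
        fun u => iidMean_eval hr1 j (fun b => w (u i) b * w (u i) b)
      simp only [e]
      rw [iidMean_eval hq1 i (fun a => ∑ b, r b * (w a b * w a b)), ← hg, Finset.mul_sum]
      refine Finset.sum_le_sum fun a _ => ?_
      rw [mul_left_comm]
      refine mul_le_mul_of_nonneg_left ?_ (hq a)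
      rw [Finset.mul_sum]
      refine Finset.sum_le_sum fun b _ => ?_
      rw [mul_left_comm W]
      exact mul_le_mul_of_nonneg_left (mul_le_mul_of_nonneg_right (hW a b) (hw a b)) (hr b)
    nlinarith [sq_nonneg g]
  · have := iidMean_weight_mul_weight_of_ne_le hq hq1 hr1 hr hw hs i hj
    rw [hg] at this
    simp only [if_true, if_neg hj]
    nlinarith [sq_nonneg g]
  · have := iidMean_weight_mul_weight_of_ne_le (w := fun b a => w a b) hr hr1 hq1 hq
      (fun b a => hw a b) ht j hi
    rw [hg', ← iidMean_comm] at this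
    simp only [if_true, if_neg hi]
    nlinarith [sq_nonneg g]
  · simp only [iidMean_eval_mul_eval hr1 hj]
    rw [iidMean_eval_mul_eval hq1 hi (fun a => ∑ b, r b * w a b) (fun a => ∑ b, r b * w a b), hg]
    simp only [if_neg hi, if_neg hj]
    nlinarith

end MutualCovering

section Codebook

variable {α β : Type*} [Fintype α] [Fintype β] {q : α → ℝ} {r : β → ℝ} {w : α → β → ℝ} {W : ℝ}

theorem iidMean_weight_mul {ι κ : Type*} [Fintype ι] [Fintype κ] [DecidableEq ι] [DecidableEq κ]
    (hq1 : ∑ a, q a = 1) (hr1 : ∑ b, r b = 1) (h : α → β → ℝ) (i : ι) (j : κ) :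
    iidMean q (fun u : ι → α => iidMean r (fun v : κ → β => w (u i) (v j) * h (u i) (v j)))
      = ∑ a, q a * ∑ b, r b * (w a b * h a b) := by
  have e : ∀ u : ι → α, iidMean r (fun v : κ → β => w (u i) (v j) * h (u i) (v j))
      = ∑ b, r b * (w (u i) b * h (u i) b) :=
    fun u => iidMean_eval hr1 j (fun b => w (u i) b * h (u i) b)
  simp only [e]
  exact iidMean_eval hq1 i (fun a => ∑ b, r b * (w a b * h a b))

theorem iidMean_weight_mul_other_fst {ι κ : Type*} [Fintype ι] [Fintype κ] [DecidableEq ι]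
    [DecidableEq κ] (hq1 : ∑ a, q a = 1) (hr1 : ∑ b, r b = 1) (φ : α → α → β → ℝ) {i i' : ι}
    (hi : i ≠ i') (j : κ) :
    iidMean q (fun u : ι → α => iidMean r (fun v : κ → β =>
        w (u i) (v j) * φ (u i') (u i) (v j)))
      = ∑ a, q a * ∑ a', q a' * ∑ b, r b * (w a b * φ a' a b) := by
  have e : ∀ u : ι → α, iidMean r (fun v : κ → β => w (u i) (v j) * φ (u i') (u i) (v j))
      = ∑ b, r b * (w (u i) b * φ (u i') (u i) b) :=
    fun u => iidMean_eval hr1 j (fun b => w (u i) b * φ (u i') (u i) b)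
  simp only [e]
  exact iidMean_eval₂ hq1 hi (fun a a' => ∑ b, r b * (w a b * φ a' a b))

theorem iidMean_weight_mul_other_snd {ι κ : Type*} [Fintype ι] [Fintype κ] [DecidableEq ι]
    [DecidableEq κ] (hq1 : ∑ a, q a = 1) (hr1 : ∑ b, r b = 1) (ψ : β → α → β → ℝ) (i : ι)
    {j j' : κ} (hj : j ≠ j') :
    iidMean q (fun u : ι → α => iidMean r (fun v : κ → β =>
        w (u i) (v j) * ψ (v j') (u i) (v j)))
      = ∑ b, r b * ∑ b', r b' * ∑ a, q a * (w a b * ψ b' a b) := by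
  rw [iidMean_comm]
  exact iidMean_weight_mul_other_fst (w := fun b a => w a b) hr1 hq1 (fun b' b a => ψ b' a b) hj i

/-- The variance of the total weight of a pair of bins; `s` and `t` pick out the bins in the two
codebooks. -/
theorem iidMean_variance_le {ι κ K L : Type*} [Fintype ι] [Fintype κ] [DecidableEq ι]
    [DecidableEq κ] [Fintype K] [Fintype L] (hq : ∀ a, 0 ≤ q a) (hq1 : ∑ a, q a = 1)
    (hr : ∀ b, 0 ≤ r b) (hr1 : ∑ b, r b = 1) (hw : ∀ a b, 0 ≤ w a b) (hW : ∀ a b, w a b ≤ W)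
    (hs : ∀ a, ∑ b, r b * w a b ≤ 1) (ht : ∀ b, ∑ a, q a * w a b ≤ 1) {g : ℝ}
    (hg : ∑ a, q a * ∑ b, r b * w a b = g) {s : K → ι} (hs' : s.Injective) {t : L → κ}
    (ht' : t.Injective) :
    iidMean q (fun u : ι → α => iidMean r (fun v : κ → β =>
        (∑ x : K × L, w (u (s x.1)) (v (t x.2)) - Fintype.card K * Fintype.card L * g) ^ 2))
      ≤ Fintype.card K * (Fintype.card L : ℝ) * g *
          (Fintype.card L + Fintype.card K + W) := by
  classical
  set k : ℝ := (Fintype.card K : ℝ) with hk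
  set l : ℝ := (Fintype.card L : ℝ) with hl
  set μ : ℝ := k * l * g with hμ
  have expand : ∀ (u : ι → α) (v : κ → β),
      (∑ x : K × L, w (u (s x.1)) (v (t x.2)) - μ) ^ 2
        = ∑ x : K × L, ∑ y : K × L,
            w (u (s x.1)) (v (t x.2)) * w (u (s y.1)) (v (t y.2))
          + ((-2 * μ) * ∑ x : K × L, w (u (s x.1)) (v (t x.2)) + μ ^ 2) := by
    intro u v
    rw [← Finset.sum_mul_sum]
    ring
  have hfirst : ∀ x : K × L,
      iidMean q (fun u : ι → α => iidMean r (fun v : κ → β => w (u (s x.1)) (v (t x.2)))) = g := by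
    intro x
    have := iidMean_weight_mul (w := w) hq1 hr1 (fun _ _ => 1) (s x.1) (t x.2)
    simpa [hg] using this
  simp only [expand, iidMean_add, iidMean_sum, iidMean_const_mul, iidMean_const hr1,
    iidMean_const hq1, hfirst]
  have hsecond : ∀ x y : K × L,
      iidMean q (fun u : ι → α => iidMean r (fun v : κ → β =>
        w (u (s x.1)) (v (t x.2)) * w (u (s y.1)) (v (t y.2))))
      ≤ g ^ 2 + (if x.1 = y.1 then g else 0) + (if x.2 = y.2 then g else 0)
        + (if x.1 = y.1 then if x.2 = y.2 then W * g else 0 else 0) := by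
    intro x y
    have := iidMean_weight_mul_weight_le hq hq1 hr hr1 hw hW hs ht hg (s x.1) (s y.1)
      (t x.2) (t y.2)
    simpa only [hs'.eq_iff, ht'.eq_iff] using this
  have hsum := Finset.sum_le_sum fun (x : K × L) (_ : x ∈ Finset.univ) =>
    Finset.sum_le_sum fun (y : K × L) (_ : y ∈ Finset.univ) => hsecond x y
  refine (add_le_add_left hsum _).trans (le_of_eq ?_)
  have hcard : (Fintype.card (K × L) : ℝ) = k * l := by
    rw [Fintype.card_prod, Nat.cast_mul]
  have hsum₁ : ∑ x : K × L, ∑ y : K × L, (if x.1 = y.1 then g else 0) = k * l * (l * g) := by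
    have : ∀ x : K × L, ∑ y : K × L, (if x.1 = y.1 then g else 0) = l * g := fun x => by
      rw [Fintype.sum_prod_type, Finset.sum_comm]
      simp [hl]
    simp [this, mul_assoc, ← hk, ← hl]
  have hsum₂ : ∑ x : K × L, ∑ y : K × L, (if x.2 = y.2 then g else 0) = k * l * (k * g) := by
    have : ∀ x : K × L, ∑ y : K × L, (if x.2 = y.2 then g else 0) = k * g := fun x => by
      rw [Fintype.sum_prod_type]
      simp [hk]
    simp [this, mul_assoc, ← hk, ← hl]
  have hsum₃ : ∑ x : K × L, ∑ y : K × L, (if x.1 = y.1 then if x.2 = y.2 then W * g else 0 else 0)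
      = k * l * (W * g) := by
    have : ∀ x : K × L,
        ∑ y : K × L, (if x.1 = y.1 then if x.2 = y.2 then W * g else 0 else 0) = W * g := by
      intro x
      rw [Fintype.sum_prod_type, Finset.sum_comm]
      simp
    simp [this, mul_assoc, ← hk, ← hl]
  simp only [Finset.sum_add_distrib, hsum₁, hsum₂, hsum₃, Finset.sum_const, Finset.card_univ,
    nsmul_eq_mul, hcard]
  rw [hμ]
  ring

/-- Some codebook, with some choice `x` of a pair of bin elements for each message pair, does as
well as the random one. The error `e u v i j` of sending the codewords `u i` and `v j` is assumed to be
at most a term `h` depending on these two codewords only, plus interference terms `φ` and `ψ` from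
each of the other codewords. -/
theorem exists_codebook {M₁ M₂ K L : Type*} [Fintype M₁] [Fintype M₂] [Fintype K] [Fintype L]
    [DecidableEq M₁] [DecidableEq M₂] [DecidableEq K] [DecidableEq L]
    [Nonempty M₁] [Nonempty M₂] [Nonempty K] [Nonempty L]
    (hq : ∀ a, 0 ≤ q a) (hq1 : ∑ a, q a = 1)
    (hr : ∀ b, 0 ≤ r b) (hr1 : ∑ b, r b = 1) (hw : ∀ a b, 0 ≤ w a b) (hW : ∀ a b, w a b ≤ W)
    (hs : ∀ a, ∑ b, r b * w a b ≤ 1) (ht : ∀ b, ∑ a, q a * w a b ≤ 1) {g : ℝ} (hg0 : 0 < g)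
    (hg : ∑ a, q a * ∑ b, r b * w a b = g)
    {e : (M₁ × K → α) → (M₂ × L → β) → M₁ × K → M₂ × L → ℝ}
    (he0 : ∀ u v i j, 0 ≤ e u v i j) (he1 : ∀ u v i j, e u v i j ≤ 1)
    {h : α → β → ℝ} {φ : α → α → β → ℝ} {ψ : β → α → β → ℝ} {H Φ Ψ : ℝ}
    (hle : ∀ u v i j, e u v i j ≤ h (u i) (v j)
      + ∑ i' ∈ Finset.univ.erase i, φ (u i') (u i) (v j)
      + ∑ j' ∈ Finset.univ.erase j, ψ (v j') (u i) (v j))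
    (hH : ∑ a, q a * ∑ b, r b * (w a b * h a b) ≤ H)
    (hΦ0 : 0 ≤ Φ) (hΦ : ∑ a, q a * ∑ a', q a' * ∑ b, r b * (w a b * φ a' a b) ≤ Φ)
    (hΨ0 : 0 ≤ Ψ) (hΨ : ∑ b, r b * ∑ b', r b' * ∑ a, q a * (w a b * ψ b' a b) ≤ Ψ) :
    ∃ (u : M₁ × K → α) (v : M₂ × L → β) (x : M₁ × M₂ → K × L),
      (∑ m : M₁ × M₂, e u v (m.1, (x m).1) (m.2, (x m).2))
          / ((Fintype.card M₁ : ℝ) * Fintype.card M₂)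
        ≤ 2 / g * (H + Fintype.card M₁ * Fintype.card K * Φ
            + Fintype.card M₂ * Fintype.card L * Ψ)
          + 4 / g * (1 / Fintype.card K + 1 / Fintype.card L
            + W / (Fintype.card K * Fintype.card L)) := by
  set k : ℝ := (Fintype.card K : ℝ) with hk
  set l : ℝ := (Fintype.card L : ℝ) with hl
  have hk0 : 0 < k := by rw [hk]; exact_mod_cast Fintype.card_pos
  have hl0 : 0 < l := by rw [hl]; exact_mod_cast Fintype.card_pos
  set μ : ℝ := k * l * g with hμ
  have hμ0 : 0 < μ := by positivity
  let S (u : M₁ × K → α) (v : M₂ × L → β) (m : M₁ × M₂) : ℝ :=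
    ∑ x : K × L, w (u (m.1, x.1)) (v (m.2, x.2)) * e u v (m.1, x.1) (m.2, x.2)
  let V (u : M₁ × K → α) (v : M₂ × L → β) (m : M₁ × M₂) : ℝ :=
    (∑ x : K × L, w (u (m.1, x.1)) (v (m.2, x.2)) - μ) ^ 2
  have hchoose : ∀ u v (m : M₁ × M₂), ∃ x : K × L,
      e u v (m.1, x.1) (m.2, x.2) ≤ 2 / μ * S u v m + 4 / μ ^ 2 * V u v m := fun u v m =>
    exists_le_weighted_mean hμ0 (fun x => hw _ _) (fun x => he0 _ _ _ _) (fun x => he1 _ _ _ _)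
  choose x hx using hchoose
  have hS : ∀ m, iidMean q (fun u => iidMean r (fun v => S u v m))
      ≤ k * l * (H + Fintype.card M₁ * k * Φ + Fintype.card M₂ * l * Ψ) := by
    intro m
    have hterm : ∀ y : K × L, iidMean q (fun u => iidMean r (fun v =>
        w (u (m.1, y.1)) (v (m.2, y.2)) * e u v (m.1, y.1) (m.2, y.2)))
        ≤ H + Fintype.card M₁ * k * Φ + Fintype.card M₂ * l * Ψ := by
      intro y
      refine (iidMean_mono hq fun u => iidMean_mono hr fun v =>
        mul_le_mul_of_nonneg_left (hle u v (m.1, y.1) (m.2, y.2)) (hw _ _)).trans ?_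
      simp only [mul_add, Finset.mul_sum, iidMean_add, iidMean_sum]
      refine add_le_add (add_le_add ?_ ?_) ?_
      · exact (iidMean_weight_mul hq1 hr1 h _ _).trans_le hH
      · refine (Finset.sum_le_card_nsmul _ _ Φ fun i' hi' => ?_).trans ?_
        · exact (iidMean_weight_mul_other_fst hq1 hr1 φ
            (Finset.ne_of_mem_erase hi').symm _).trans_le hΦ
        · rw [nsmul_eq_mul]
          refine mul_le_mul_of_nonneg_right ?_ hΦ0
          rw [hk, ← Nat.cast_mul, ← Fintype.card_prod]
          exact_mod_cast Finset.card_le_univ _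
      · refine (Finset.sum_le_card_nsmul _ _ Ψ fun j' hj' => ?_).trans ?_
        · exact (iidMean_weight_mul_other_snd hq1 hr1 ψ _
            (Finset.ne_of_mem_erase hj').symm).trans_le hΨ
        · rw [nsmul_eq_mul]
          refine mul_le_mul_of_nonneg_right ?_ hΨ0
          rw [hl, ← Nat.cast_mul, ← Fintype.card_prod]
          exact_mod_cast Finset.card_le_univ _
    simp only [S, iidMean_sum]
    refine (Finset.sum_le_card_nsmul _ _ _ fun y _ => hterm y).trans (le_of_eq ?_)
    rw [nsmul_eq_mul, Finset.card_univ, Fintype.card_prod, Nat.cast_mul]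
  have hV : ∀ m, iidMean q (fun u => iidMean r (fun v => V u v m)) ≤ k * l * g * (l + k + W) :=
    fun m => iidMean_variance_le hq hq1 hr hr1 hw hW hs ht hg (Prod.mk_right_injective m.1)
      (Prod.mk_right_injective m.2)
  obtain ⟨u, hu⟩ := exists_le_iidMean hq hq1 (fun u => iidMean r (fun v =>
    ∑ m : M₁ × M₂, (2 / μ * S u v m + 4 / μ ^ 2 * V u v m)))
  obtain ⟨v, hv⟩ := exists_le_iidMean hr hr1 (fun v =>
    ∑ m : M₁ × M₂, (2 / μ * S u v m + 4 / μ ^ 2 * V u v m))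
  refine ⟨u, v, x u v, ?_⟩
  have hM : 0 < (Fintype.card M₁ : ℝ) * Fintype.card M₂ := by
    have := Fintype.card_pos (α := M₁)
    have := Fintype.card_pos (α := M₂)
    positivity
  rw [div_le_iff₀ hM]
  refine ((Finset.sum_le_sum fun m _ => hx u v m).trans (hv.trans hu)).trans ?_
  simp only [iidMean_sum, iidMean_add, iidMean_const_mul]
  refine (Finset.sum_le_card_nsmul _ _ _ fun m _ => add_le_add
    (mul_le_mul_of_nonneg_left (hS m) (by positivity))
    (mul_le_mul_of_nonneg_left (hV m) (by positivity))).trans (le_of_eq ?_)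
  rw [nsmul_eq_mul, Finset.card_univ, Fintype.card_prod, Nat.cast_mul, hμ]
  field_simp

end Codebook

/-! ### Traces, partial traces and effects -/

section Traces

theorem trace_mul_re_nonneg {n : Type*} [Fintype n] {A ρ : Matrix n n ℂ} (hA : 0 ≤ A) (hρ : 0 ≤ ρ) :
    0 ≤ (A * ρ).trace.re := by
  classical
  obtain ⟨X, rfl⟩ := CStarAlgebra.nonneg_iff_eq_star_mul_self.mp hρ
  rw [← mul_assoc, Matrix.trace_mul_comm, ← mul_assoc]
  have := (Matrix.nonneg_iff_posSemidef.1 (star_right_conjugate_nonneg hA X)).trace_nonneg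
  exact (Complex.le_def.1 this).1

theorem trace_mul_re_mono {n : Type*} [Fintype n] {A B ρ : Matrix n n ℂ} (hAB : A ≤ B)
    (hρ : 0 ≤ ρ) :
    (A * ρ).trace.re ≤ (B * ρ).trace.re := by
  have := trace_mul_re_nonneg (sub_nonneg.2 hAB) hρ
  rw [sub_mul, Matrix.trace_sub, Complex.sub_re] at this
  linarith

theorem traceRight_nonneg {b c : Type*} [Fintype c] {ρ : Matrix (b × c) (b × c) ℂ} (hρ : 0 ≤ ρ) :
    0 ≤ traceRight ρ := by
  have : traceRight ρ = ∑ k, ρ.submatrix (fun i => (i, k)) (fun i => (i, k)) := by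
    ext i j
    simp [traceRight, Matrix.sum_apply]
  rw [this]
  exact Finset.sum_nonneg fun k _ =>
    Matrix.nonneg_iff_posSemidef.2 ((Matrix.nonneg_iff_posSemidef.1 hρ).submatrix _)

theorem traceLeft_nonneg {b c : Type*} [Fintype b] {ρ : Matrix (b × c) (b × c) ℂ} (hρ : 0 ≤ ρ) :
    0 ≤ traceLeft ρ := by
  have : traceLeft ρ = ∑ k, ρ.submatrix (fun i => (k, i)) (fun i => (k, i)) := by
    ext i j
    simp [traceLeft, Matrix.sum_apply]
  rw [this]
  exact Finset.sum_nonneg fun k _ =>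
    Matrix.nonneg_iff_posSemidef.2 ((Matrix.nonneg_iff_posSemidef.1 hρ).submatrix _)

variable {b c : Type*} [Fintype b] [Fintype c]

theorem trace_traceRight (ρ : Matrix (b × c) (b × c) ℂ) : (traceRight ρ).trace = ρ.trace := by
  simp [Matrix.trace, traceRight, Fintype.sum_prod_type]

theorem trace_traceLeft (ρ : Matrix (b × c) (b × c) ℂ) : (traceLeft ρ).trace = ρ.trace := by
  simp only [Matrix.trace, traceLeft, Fintype.sum_prod_type, Matrix.diag_apply]
  exact Finset.sum_comm

theorem trace_kronecker_one_mul [DecidableEq c] (P : Matrix b b ℂ) (ρ : Matrix (b × c) (b × c) ℂ) :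
    ((P ⊗ₖ (1 : Matrix c c ℂ)) * ρ).trace = (P * traceRight ρ).trace := by
  simp only [Matrix.trace, Matrix.diag_apply, Matrix.mul_apply, Fintype.sum_prod_type,
    Matrix.kronecker_apply, Matrix.one_apply, traceRight, mul_ite, mul_one, mul_zero, ite_mul,
    zero_mul, Finset.sum_ite_eq, Finset.mem_univ, if_true, Finset.mul_sum]
  exact Finset.sum_congr rfl fun i _ => Finset.sum_comm

theorem trace_one_kronecker_mul [DecidableEq b] (Q : Matrix c c ℂ) (ρ : Matrix (b × c) (b × c) ℂ) :
    (((1 : Matrix b b ℂ) ⊗ₖ Q) * ρ).trace = (Q * traceLeft ρ).trace := by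
  simp only [Matrix.trace, Matrix.diag_apply, Matrix.mul_apply, Fintype.sum_prod_type,
    Matrix.kronecker_apply, Matrix.one_apply, traceLeft, ite_mul, one_mul,
    zero_mul, Finset.mul_sum]
  simp only [Finset.sum_ite_irrel, Finset.sum_const_zero, Finset.sum_ite_eq, Finset.mem_univ,
    if_true]
  rw [Finset.sum_comm]
  exact Finset.sum_congr rfl fun i _ => Finset.sum_comm

theorem sub_kronecker_eq {b c : Type*} (A B : Matrix b b ℂ) (Q : Matrix c c ℂ) :
    (A - B) ⊗ₖ Q = A ⊗ₖ Q - B ⊗ₖ Q := by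
  ext i j
  simp [sub_mul]

theorem kronecker_sub_eq {b c : Type*} (P : Matrix b b ℂ) (A B : Matrix c c ℂ) :
    P ⊗ₖ (A - B) = P ⊗ₖ A - P ⊗ₖ B := by
  ext i j
  simp [mul_sub]

theorem kronecker_nonneg {P : Matrix b b ℂ} {Q : Matrix c c ℂ} (hP : 0 ≤ P) (hQ : 0 ≤ Q) :
    0 ≤ P ⊗ₖ Q :=
  Matrix.nonneg_iff_posSemidef.2
    ((Matrix.nonneg_iff_posSemidef.1 hP).kronecker (Matrix.nonneg_iff_posSemidef.1 hQ))

variable [DecidableEq b] [DecidableEq c]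

theorem one_sub_kronecker_le {P : Matrix b b ℂ} {Q : Matrix c c ℂ} (hP : P ≤ 1) (hQ : Q ≤ 1) :
    1 - P ⊗ₖ Q ≤ (1 - P) ⊗ₖ 1 + 1 ⊗ₖ (1 - Q) := by
  have h := kronecker_nonneg (sub_nonneg.2 hP) (sub_nonneg.2 hQ)
  rw [← sub_nonneg]
  convert h using 1
  simp only [sub_kronecker_eq, kronecker_sub_eq, Matrix.one_kronecker_one]
  abel

theorem kronecker_le_one {P : Matrix b b ℂ} {Q : Matrix c c ℂ} (hP0 : 0 ≤ P) (hP : P ≤ 1)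
    (hQ : Q ≤ 1) : P ⊗ₖ Q ≤ 1 := by
  have h := add_nonneg (kronecker_nonneg (sub_nonneg.2 hP) (zero_le_one' (Matrix c c ℂ)))
    (kronecker_nonneg hP0 (sub_nonneg.2 hQ))
  rw [← sub_nonneg]
  convert h using 1
  simp only [sub_kronecker_eq, kronecker_sub_eq, Matrix.one_kronecker_one]
  abel

theorem trace_one_sub_kronecker_mul_le {P : Matrix b b ℂ} {Q : Matrix c c ℂ}
    {ρ : Matrix (b × c) (b × c) ℂ} (hP : P ≤ 1) (hQ : Q ≤ 1) (hρ : 0 ≤ ρ) :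
    ((1 - P ⊗ₖ Q) * ρ).trace.re
      ≤ ((1 - P) * traceRight ρ).trace.re + ((1 - Q) * traceLeft ρ).trace.re := by
  have := trace_mul_re_mono (one_sub_kronecker_le hP hQ) hρ
  rwa [add_mul, Matrix.trace_add, Complex.add_re, trace_kronecker_one_mul,
    trace_one_kronecker_mul] at this

theorem IsPOVM.le_one {b M : Type*} [Fintype b] [DecidableEq b] [Fintype M]
    {T : M → Matrix b b ℂ} (hT : IsPOVM T) (m : M) :
    T m ≤ 1 := by
  rw [← hT.sum_eq_one]
  exact Finset.single_le_sum (fun i _ => Matrix.nonneg_iff_posSemidef.2 (hT.posSemidef i))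
    (Finset.mem_univ m)

/-- The diagonal blocks of a test on `𝒰 × b` against a state that is classical on `𝒰`. -/
theorem exists_tests_of_lt_smoothMin {𝒰 : Type*} [Fintype 𝒰] [DecidableEq 𝒰] {ε a : ℝ}
    {D : Matrix (𝒰 × b) (𝒰 × b) ℂ} {A : 𝒰 → Matrix b b ℂ} {q : 𝒰 → ℝ}
    (hD : ∀ i j, D i j = if i.1 = j.1 then A i.1 i.2 j.2 else 0)
    (hq : ∀ u, (A u).trace = q u) (ha : (a : EReal) < smoothMin ε D) :
    ∃ Γ : 𝒰 → Matrix b b ℂ, (∀ u, 0 ≤ Γ u) ∧ (∀ u, Γ u ≤ 1) ∧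
      1 - ε < ∑ u, (Γ u * A u).trace.re ∧
      ∑ u, q u * ∑ u', (Γ u * A u').trace.re ≤ (2 : ℝ) ^ (-a) := by
  simp only [smoothMin, lt_iSup_iff] at ha
  obtain ⟨Γ, ⟨h0, h1, h2⟩, h3⟩ := ha
  have htr : (Γ * D).trace = ∑ u, (Γ.submatrix (Prod.mk u) (Prod.mk u) * A u).trace := by
    simp only [Matrix.trace, Matrix.diag_apply, Matrix.mul_apply, Fintype.sum_prod_type, hD,
      Matrix.submatrix_apply, mul_ite, mul_zero]
    refine Finset.sum_congr rfl fun u _ => Finset.sum_congr rfl fun y _ => ?_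
    rw [Finset.sum_comm]
    simp
  have hR : traceRight D = Matrix.diagonal fun u => (q u : ℂ) := by
    ext u u'
    rcases eq_or_ne u u' with rfl | h
    · simp [traceRight, hD, ← hq, Matrix.trace]
    · simp [traceRight, hD, h]
  have hL : traceLeft D = ∑ u, A u := by
    ext y y'
    simp [traceLeft, hD, Matrix.sum_apply]
  have htr' : (Γ * (traceRight D ⊗ₖ traceLeft D)).trace
      = ∑ u, q u * ∑ u', (Γ.submatrix (Prod.mk u) (Prod.mk u) * A u').trace := by
    rw [hR, hL]
    simp only [← Matrix.trace_sum, ← Finset.mul_sum]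
    generalize ∑ u, A u = B
    simp only [Matrix.trace, Matrix.diag_apply, Matrix.mul_apply, Fintype.sum_prod_type,
      Matrix.kronecker_apply, Matrix.diagonal_apply, Matrix.submatrix_apply, ite_mul, zero_mul,
      mul_ite, mul_zero, Finset.mul_sum]
    refine Finset.sum_congr rfl fun u _ => Finset.sum_congr rfl fun y _ => ?_
    rw [Finset.sum_comm]
    simp [mul_left_comm]
  refine ⟨fun u => Γ.submatrix (Prod.mk u) (Prod.mk u),
    fun u => Matrix.nonneg_iff_posSemidef.2 (h0.submatrix _), fun u => ?_, ?_, ?_⟩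
  · have := h1.submatrix (Prod.mk u)
    rw [Matrix.submatrix_sub, Pi.sub_apply, Pi.sub_apply,
      Matrix.submatrix_one _ (Prod.mk_right_injective u)] at this
    exact this
  · rwa [htr, Complex.re_sum] at h2
  · rw [htr'] at h3
    have e : (∑ u, (q u : ℂ) * ∑ u', (Γ.submatrix (Prod.mk u) (Prod.mk u) * A u').trace).re
        = ∑ u, q u * ∑ u', (Γ.submatrix (Prod.mk u) (Prod.mk u) * A u').trace.re := by
      simp only [Complex.re_sum, Complex.re_ofReal_mul]
    rw [e] at h3
    generalize ∑ u, q u * ∑ u', (Γ.submatrix (Prod.mk u) (Prod.mk u) * A u').trace.re = x at *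
    unfold elog at h3
    split_ifs at h3 with hx
    · rw [← EReal.coe_neg, EReal.coe_lt_coe_iff] at h3
      have : Real.logb 2 x ≤ -a := by linarith
      exact (Real.logb_le_iff_le_rpow one_lt_two hx).1 this
    · exact (not_lt.1 hx).trans (Real.rpow_nonneg zero_le_two _)

end Traces

/-! ### Tests against the marginal states -/

section Marginals

variable {𝒳 𝒰 𝒱 b c : Type*} [Fintype 𝒰] [Fintype 𝒱] [Fintype b] [Fintype c]
    [DecidableEq 𝒰] [DecidableEq 𝒱]

theorem stateUVBC_apply (N : Channel 𝒳 b c) (p : 𝒰 × 𝒱 → ℝ) (f : 𝒰 × 𝒱 → 𝒳)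
    (u u' : 𝒰) (v v' : 𝒱) (y y' : b × c) :
    stateUVBC N p f (u, v, y) (u', v', y')
      = if u = u' ∧ v = v' then (p (u, v) : ℂ) * N.state (f (u, v)) y y' else 0 := by
  rw [stateUVBC, Matrix.sum_apply, Finset.sum_eq_single (u, v)]
  · simp only [Matrix.smul_apply, Matrix.kronecker_apply, Matrix.single_apply, smul_eq_mul,
      true_and]
    split_ifs <;> simp_all
  · rintro ⟨a, b⟩ - hne
    have : ¬(a = u ∧ b = v) := by simpa using hne
    simp only [Matrix.smul_apply, Matrix.kronecker_apply, Matrix.single_apply, smul_eq_mul]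
    by_cases ha : a = u
    · have hb : b ≠ v := fun hb => this ⟨ha, hb⟩
      simp [hb]
    · simp [ha]
  · simp

theorem marginalUB_stateUVBC (N : Channel 𝒳 b c) (p : 𝒰 × 𝒱 → ℝ) (f : 𝒰 × 𝒱 → 𝒳)
    (i j : 𝒰 × b) :
    marginalUB (stateUVBC N p f) i j
      = if i.1 = j.1 then
          (∑ v, (p (i.1, v) : ℂ) • traceRight (N.state (f (i.1, v)))) i.2 j.2 else 0 := by
  simp only [marginalUB, stateUVBC_apply, and_true]
  split_ifs
  · simp [Matrix.sum_apply, traceRight, Finset.mul_sum]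
  · simp

theorem marginalVC_stateUVBC (N : Channel 𝒳 b c) (p : 𝒰 × 𝒱 → ℝ) (f : 𝒰 × 𝒱 → 𝒳)
    (i j : 𝒱 × c) :
    marginalVC (stateUVBC N p f) i j
      = if i.1 = j.1 then
          (∑ u, (p (u, i.1) : ℂ) • traceLeft (N.state (f (u, i.1)))) i.2 j.2 else 0 := by
  simp only [marginalVC, stateUVBC_apply, true_and]
  split_ifs
  · simp [Matrix.sum_apply, traceLeft, Finset.mul_sum]
  · simp

theorem exists_tests_fst [DecidableEq b] (N : Channel 𝒳 b c) (p : 𝒰 × 𝒱 → ℝ)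
    (f : 𝒰 × 𝒱 → 𝒳) {ε a : ℝ}
    (ha : (a : EReal) < smoothMin ε (marginalUB (stateUVBC N p f))) :
    ∃ Γ : 𝒰 → Matrix b b ℂ, (∀ u, 0 ≤ Γ u) ∧ (∀ u, Γ u ≤ 1) ∧
      1 - ε < ∑ w, p w * (Γ w.1 * traceRight (N.state (f w))).trace.re ∧
      ∑ u, marginalFst p u * ∑ w, p w * (Γ u * traceRight (N.state (f w))).trace.re
        ≤ (2 : ℝ) ^ (-a) := by
  have hq : ∀ u, (∑ v, (p (u, v) : ℂ) • traceRight (N.state (f (u, v)))).trace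
      = marginalFst p u := fun u => by
    simp [Matrix.trace_sum, trace_traceRight, (N.isDensityMatrix _).trace_eq_one, marginalFst]
  obtain ⟨Γ, h0, h1, h2, h3⟩ := exists_tests_of_lt_smoothMin (marginalUB_stateUVBC N p f) hq ha
  refine ⟨Γ, h0, h1, ?_, ?_⟩
  · simpa [Matrix.mul_sum, Matrix.trace_sum, Fintype.sum_prod_type] using h2
  · simpa [Matrix.mul_sum, Matrix.trace_sum, Fintype.sum_prod_type] using h3

theorem exists_tests_snd [DecidableEq c] (N : Channel 𝒳 b c) (p : 𝒰 × 𝒱 → ℝ)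
    (f : 𝒰 × 𝒱 → 𝒳) {ε a : ℝ}
    (ha : (a : EReal) < smoothMin ε (marginalVC (stateUVBC N p f))) :
    ∃ Γ : 𝒱 → Matrix c c ℂ, (∀ v, 0 ≤ Γ v) ∧ (∀ v, Γ v ≤ 1) ∧
      1 - ε < ∑ w, p w * (Γ w.2 * traceLeft (N.state (f w))).trace.re ∧
      ∑ v, marginalSnd p v * ∑ w, p w * (Γ v * traceLeft (N.state (f w))).trace.re
        ≤ (2 : ℝ) ^ (-a) := by
  have hq : ∀ v, (∑ u, (p (u, v) : ℂ) • traceLeft (N.state (f (u, v)))).trace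
      = marginalSnd p v := fun v => by
    simp [Matrix.trace_sum, trace_traceLeft, (N.isDensityMatrix _).trace_eq_one, marginalSnd]
  obtain ⟨Γ, h0, h1, h2, h3⟩ := exists_tests_of_lt_smoothMin (marginalVC_stateUVBC N p f) hq ha
  refine ⟨Γ, h0, h1, ?_, ?_⟩
  · simpa [Matrix.mul_sum, Matrix.trace_sum, Fintype.sum_prod_type_right] using h2
  · simpa [Matrix.mul_sum, Matrix.trace_sum, Fintype.sum_prod_type_right] using h3

end Marginals

theorem exists_finset_of_smoothMax_lt {𝒰 𝒱 : Type*} [Fintype 𝒰] [Fintype 𝒱] {p : 𝒰 × 𝒱 → ℝ}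
    {ε s : ℝ} (hs : smoothMax ε p < (s : EReal)) :
    ∃ G : Finset (𝒰 × 𝒱), 1 - ε < ∑ w ∈ G, p w ∧
      ∀ w ∈ G, p w / (marginalFst p w.1 * marginalSnd p w.2) ≤ (2 : ℝ) ^ s := by
  simp only [smoothMax, iInf_lt_iff] at hs
  obtain ⟨G, hG, hlt⟩ := hs
  refine ⟨G, hG, fun w hw => ?_⟩
  have h := (le_iSup₂ (f := fun (w : 𝒰 × 𝒱) (_ : w ∈ G) =>
    elog (p w / (marginalFst p w.1 * marginalSnd p w.2))) w hw).trans_lt hlt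
  unfold elog at h
  split_ifs at h with hx
  · exact (Real.logb_le_iff_le_rpow one_lt_two hx).1 (EReal.coe_lt_coe_iff.1 h).le
  · exact (not_lt.1 hx).trans (Real.rpow_nonneg zero_le_two _)

/-! ### Truncated likelihood ratios -/

theorem marginalFst_nonneg {𝒰 𝒱 : Type*} [Fintype 𝒱] {p : 𝒰 × 𝒱 → ℝ} (hp : ∀ w, 0 ≤ p w)
    (u : 𝒰) : 0 ≤ marginalFst p u :=
  Finset.sum_nonneg fun _ _ => hp _

theorem marginalSnd_nonneg {𝒰 𝒱 : Type*} [Fintype 𝒰] {p : 𝒰 × 𝒱 → ℝ} (hp : ∀ w, 0 ≤ p w)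
    (v : 𝒱) : 0 ≤ marginalSnd p v :=
  Finset.sum_nonneg fun _ _ => hp _

theorem sum_marginalFst {𝒰 𝒱 : Type*} [Fintype 𝒰] [Fintype 𝒱] (p : 𝒰 × 𝒱 → ℝ) :
    ∑ u, marginalFst p u = ∑ w, p w := by
  rw [Fintype.sum_prod_type]; rfl

theorem sum_marginalSnd {𝒰 𝒱 : Type*} [Fintype 𝒰] [Fintype 𝒱] (p : 𝒰 × 𝒱 → ℝ) :
    ∑ v, marginalSnd p v = ∑ w, p w := by
  rw [Fintype.sum_prod_type_right]; rfl

/-- Where a marginal vanishes the ratio has its junk value `0`, and so has `p`. -/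
theorem marginalFst_mul_marginalSnd_mul {𝒰 𝒱 : Type*} [Fintype 𝒰] [Fintype 𝒱] {p : 𝒰 × 𝒱 → ℝ}
    (hp : ∀ w, 0 ≤ p w) (u : 𝒰) (v : 𝒱) :
    marginalFst p u * (marginalSnd p v * (p (u, v) / (marginalFst p u * marginalSnd p v)))
      = p (u, v) := by
  rw [← mul_assoc]
  rcases eq_or_ne (marginalFst p u * marginalSnd p v) 0 with h | h
  · rw [h, zero_mul]
    rcases mul_eq_zero.1 h with h | h
    · exact ((Finset.sum_eq_zero_iff_of_nonneg fun v _ => hp (u, v)).1 h v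
        (Finset.mem_univ v)).symm
    · exact ((Finset.sum_eq_zero_iff_of_nonneg fun u _ => hp (u, v)).1 h u
        (Finset.mem_univ u)).symm
  · exact mul_div_cancel₀ _ h

section Random

variable {𝒰 𝒱 : Type*} [Fintype 𝒰] [Fintype 𝒱] [DecidableEq 𝒰] [DecidableEq 𝒱]

/-- The likelihood ratio `p(u,v) / (p(u) p(v))`, cut off outside `G`. -/
noncomputable def truncatedRatio (p : 𝒰 × 𝒱 → ℝ) (G : Finset (𝒰 × 𝒱)) (u : 𝒰) (v : 𝒱) : ℝ :=
  if (u, v) ∈ G then p (u, v) / (marginalFst p u * marginalSnd p v) else 0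

variable {p : 𝒰 × 𝒱 → ℝ} {G : Finset (𝒰 × 𝒱)}

theorem truncatedRatio_nonneg (hp : ∀ w, 0 ≤ p w) (u : 𝒰) (v : 𝒱) : 0 ≤ truncatedRatio p G u v := by
  unfold truncatedRatio
  split_ifs
  · exact div_nonneg (hp _) (mul_nonneg (marginalFst_nonneg hp u) (marginalSnd_nonneg hp v))
  · exact le_rfl

theorem marginals_mul_truncatedRatio (hp : ∀ w, 0 ≤ p w) (u : 𝒰) (v : 𝒱) :
    marginalFst p u * (marginalSnd p v * truncatedRatio p G u v)
      = if (u, v) ∈ G then p (u, v) else 0 := by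
  unfold truncatedRatio
  split_ifs
  · exact marginalFst_mul_marginalSnd_mul hp u v
  · simp

theorem sum_marginalSnd_mul_truncatedRatio_le_one (hp : ∀ w, 0 ≤ p w) (u : 𝒰) :
    ∑ v, marginalSnd p v * truncatedRatio p G u v ≤ 1 := by
  rcases (marginalFst_nonneg hp u).eq_or_lt with h | h
  · simp [truncatedRatio, ← h]
  · refine le_of_mul_le_mul_left ?_ h
    rw [Finset.mul_sum, mul_one]
    refine Finset.sum_le_sum fun v _ => ?_
    rw [marginals_mul_truncatedRatio hp]
    split_ifs
    exacts [le_rfl, hp _]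

theorem sum_marginalFst_mul_truncatedRatio_le_one (hp : ∀ w, 0 ≤ p w) (v : 𝒱) :
    ∑ u, marginalFst p u * truncatedRatio p G u v ≤ 1 := by
  rcases (marginalSnd_nonneg hp v).eq_or_lt with h | h
  · simp [truncatedRatio, ← h]
  · refine le_of_mul_le_mul_left ?_ h
    rw [Finset.mul_sum, mul_one]
    refine Finset.sum_le_sum fun u _ => ?_
    rw [mul_left_comm, marginals_mul_truncatedRatio hp]
    split_ifs
    exacts [le_rfl, hp _]

theorem sum_marginals_mul_truncatedRatio_mul (hp : ∀ w, 0 ≤ p w) (h : 𝒰 → 𝒱 → ℝ) :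
    ∑ u, marginalFst p u * ∑ v, marginalSnd p v * (truncatedRatio p G u v * h u v)
      = ∑ w ∈ G, p w * h w.1 w.2 := by
  have : ∀ u v, marginalFst p u * (marginalSnd p v * (truncatedRatio p G u v * h u v))
      = if (u, v) ∈ G then p (u, v) * h u v else 0 := fun u v => by
    rw [← mul_assoc (marginalSnd p v), ← mul_assoc, marginals_mul_truncatedRatio hp, ite_mul,
      zero_mul]
  simp only [Finset.mul_sum, this]
  rw [← Fintype.sum_prod_type' (fun u v => if (u, v) ∈ G then p (u, v) * h u v else 0)]
  simp

theorem sum_truncatedRatio_mul_le (hp : ∀ w, 0 ≤ p w) {h : 𝒰 → 𝒱 → ℝ} (hh : ∀ u v, 0 ≤ h u v) :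
    ∑ u, marginalFst p u * ∑ v, marginalSnd p v * (truncatedRatio p G u v * h u v)
      ≤ ∑ w, p w * h w.1 w.2 := by
  rw [sum_marginals_mul_truncatedRatio_mul hp]
  exact Finset.sum_le_univ_sum_of_nonneg fun w => mul_nonneg (hp w) (hh _ _)

/-- Interference from a codeword independent of the pair sent: the weight turns the law of that pair
into `p` restricted to `G`. -/
theorem sum_fst_interference_le (hp : ∀ w, 0 ≤ p w) {φ : 𝒰 → 𝒰 → 𝒱 → ℝ}
    (hφ : ∀ u' u v, 0 ≤ φ u' u v) :
    ∑ u, marginalFst p u * ∑ u', marginalFst p u' *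
        ∑ v, marginalSnd p v * (truncatedRatio p G u v * φ u' u v)
      ≤ ∑ u', marginalFst p u' * ∑ w, p w * φ u' w.1 w.2 := by
  calc _ = ∑ u', marginalFst p u' * ∑ u, marginalFst p u *
        ∑ v, marginalSnd p v * (truncatedRatio p G u v * φ u' u v) := by
        simp only [Finset.mul_sum]
        rw [Finset.sum_comm]
        exact Finset.sum_congr rfl fun u' _ => Finset.sum_congr rfl fun u _ =>
          Finset.sum_congr rfl fun v _ => by ring
    _ ≤ _ := Finset.sum_le_sum fun u' _ => mul_le_mul_of_nonneg_left
        (sum_truncatedRatio_mul_le hp (hφ u')) (marginalFst_nonneg hp u')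

theorem sum_snd_interference_le (hp : ∀ w, 0 ≤ p w) {ψ : 𝒱 → 𝒰 → 𝒱 → ℝ}
    (hψ : ∀ v' u v, 0 ≤ ψ v' u v) :
    ∑ v, marginalSnd p v * ∑ v', marginalSnd p v' *
        ∑ u, marginalFst p u * (truncatedRatio p G u v * ψ v' u v)
      ≤ ∑ v', marginalSnd p v' * ∑ w, p w * ψ v' w.1 w.2 := by
  calc _ = ∑ v', marginalSnd p v' * ∑ u, marginalFst p u *
        ∑ v, marginalSnd p v * (truncatedRatio p G u v * ψ v' u v) := by
        simp only [Finset.mul_sum]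
        rw [Finset.sum_comm]
        refine Finset.sum_congr rfl fun v' _ => ?_
        rw [Finset.sum_comm]
        exact Finset.sum_congr rfl fun u _ => Finset.sum_congr rfl fun v _ => by ring
    _ ≤ _ := Finset.sum_le_sum fun v' _ => mul_le_mul_of_nonneg_left
        (sum_truncatedRatio_mul_le hp (hψ v')) (marginalSnd_nonneg hp v')

end Random

/-! ### Rates and bin sizes -/

/-- Extended real constraints replaced by real ones, with a slack of `1` for each of the three
divergences so that the strict inequalities hold. The divergences may be infinite. -/
theorem exists_real_rates {x y z : EReal} {R₁ R₂ c₁ c₃ : ℝ}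
    (h1 : (R₁ : EReal) ≤ x - (c₁ : ℝ)) (h2 : (R₂ : EReal) ≤ y - (c₁ : ℝ))
    (h3 : ((R₁ + R₂ : ℝ) : EReal) ≤ x + y - z - (c₃ : ℝ)) :
    ∃ a a' s : ℝ, (a : EReal) < x ∧ (a' : EReal) < y ∧ z < (s : EReal) ∧
      R₁ ≤ a - c₁ + 1 ∧ R₂ ≤ a' - c₁ + 1 ∧ R₁ + R₂ ≤ a + a' - s - c₃ + 3 := by
  have hz : z ≠ ⊤ := by
    rintro rfl
    rw [sub_eq_add_neg (x + y), EReal.neg_top, EReal.add_bot, EReal.bot_sub] at h3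
    exact absurd h3 (not_le.2 (EReal.bot_lt_coe _))
  have hbot : ∀ {x : EReal} {R : ℝ}, (R : EReal) ≤ x - (c₁ : ℝ) → x ≠ ⊥ := by
    rintro x R h rfl
    rw [EReal.bot_sub] at h
    exact absurd h (not_le.2 (EReal.bot_lt_coe _))
  have hreal : ∀ {x : EReal} {R : ℝ}, (R : EReal) ≤ x - (c₁ : ℝ) →
      ∃ a : ℝ, (a : EReal) < x ∧ R ≤ a - c₁ + 1 ∧ (x = ⊤ ∨ x = ((a + 1 : ℝ) : EReal)) := by
    intro x R h
    induction x with
    | bot => exact absurd rfl (hbot h)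
    | top => exact ⟨R + c₁, EReal.coe_lt_top _, by linarith, Or.inl rfl⟩
    | coe x =>
      norm_cast at h
      exact ⟨x - 1, by norm_cast; linarith, by linarith, Or.inr (by norm_num)⟩
  obtain ⟨a, ha, ha', hx⟩ := hreal h1
  obtain ⟨b, hb, hb', hy⟩ := hreal h2
  rcases hx with rfl | rfl
  · -- the first mutual information is infinite: `a` may be chosen last
    obtain ⟨s, hs, -⟩ := EReal.lt_iff_exists_real_btwn.1 (lt_top_iff_ne_top.2 hz)
    exact ⟨max a (R₁ + R₂ - b + s + c₃), b, s, EReal.coe_lt_top _, hb, hs,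
      by linarith [le_max_left a (R₁ + R₂ - b + s + c₃)], hb',
      by linarith [le_max_right a (R₁ + R₂ - b + s + c₃)]⟩
  rcases hy with rfl | rfl
  · obtain ⟨s, hs, -⟩ := EReal.lt_iff_exists_real_btwn.1 (lt_top_iff_ne_top.2 hz)
    exact ⟨a, max b (R₁ + R₂ - a + s + c₃), s, ha, EReal.coe_lt_top _, hs, ha',
      by linarith [le_max_left b (R₁ + R₂ - a + s + c₃)],
      by linarith [le_max_right b (R₁ + R₂ - a + s + c₃)]⟩
  induction z with
  | bot => exact ⟨a, b, a + b - c₃ + 3 - R₁ - R₂, ha, hb, EReal.bot_lt_coe _, ha', hb', by linarith⟩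
  | top => exact absurd rfl hz
  | coe z =>
    norm_cast at h3
    exact ⟨a, b, z + 1, ha, hb, by norm_cast; linarith, ha', hb', by linarith⟩

/-- Bin sizes `K = ⌊A t / M₁⌋` and `L = ⌊C t / M₂⌋`. -/
theorem exists_bin_sizes {M₁ M₂ A C W t : ℝ} (hM₁ : 0 < M₁) (hM₂ : 0 < M₂) (hA : 0 < A)
    (hC : 0 < C) (hW : 0 < W) (ht : 0 < t) (ht1 : t ≤ 1) (h1 : M₁ ≤ A * t ^ 5 / 2)
    (h2 : M₂ ≤ C * t ^ 5 / 2) (h3 : M₁ * M₂ ≤ A * C / W * t ^ 11 / 4) :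
    ∃ K L : ℕ, 0 < K ∧ 0 < L ∧ M₁ * K ≤ A * t ∧ M₂ * L ≤ C * t ∧ 1 / (K : ℝ) ≤ t ∧
      1 / (L : ℝ) ≤ t ∧ W / (K * L : ℝ) ≤ t := by
  have key : ∀ {M B : ℝ}, 0 < M → 0 < B → M ≤ B * t ^ 5 / 2 →
      ∃ K : ℕ, 0 < K ∧ M * K ≤ B * t ∧ B * t ≤ 2 * (M * K) ∧ 1 / (K : ℝ) ≤ t := by
    intro M B hM hB h
    have hx : 2 / t ≤ B * t / M := by
      rw [div_le_div_iff₀ ht hM]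
      have : t ^ 5 ≤ t ^ 2 := pow_le_pow_of_le_one ht.le ht1 (by norm_num)
      have := mul_le_mul_of_nonneg_left this hB.le
      nlinarith
    have hx1 : 1 ≤ 1 / t := by rw [le_div_iff₀ ht]; linarith
    have hx2 : 2 / t = 2 * (1 / t) := by ring
    have hf := Nat.floor_le (a := B * t / M) (by positivity)
    have hf' := Nat.lt_floor_add_one (B * t / M)
    have hK : 1 / t ≤ (⌊B * t / M⌋₊ : ℝ) := by linarith
    have hK0 : (0 : ℝ) < (⌊B * t / M⌋₊ : ℝ) := by linarith
    refine ⟨⌊B * t / M⌋₊, by exact_mod_cast hK0, ?_, ?_, ?_⟩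
    · rw [le_div_iff₀ hM] at hf
      linarith
    · have : B * t / M ≤ 2 * (⌊B * t / M⌋₊ : ℝ) := by linarith
      rw [div_le_iff₀ hM] at this
      linarith
    · rw [div_le_comm₀ hK0 ht]
      exact hK
  obtain ⟨K, hK, hK1, hK2, hK3⟩ := key hM₁ hA h1
  obtain ⟨L, hL, hL1, hL2, hL3⟩ := key hM₂ hC h2
  refine ⟨K, L, hK, hL, hK1, hL1, hK3, hL3, ?_⟩
  have hK' : (0 : ℝ) < K := by exact_mod_cast hK
  have hL' : (0 : ℝ) < L := by exact_mod_cast hL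
  rw [div_le_iff₀ (by positivity)]
  have hAC : A * C * t ^ 2 ≤ 4 * (M₁ * M₂) * (K * L) := by
    have := mul_le_mul hK2 hL2 (by positivity) (by positivity)
    linarith
  have h4 : 4 * (M₁ * M₂) * (K * L) ≤ A * C / W * t ^ 11 * (K * L) :=
    mul_le_mul_of_nonneg_right (by linarith) (by positivity)
  have h5 : A * C * t ^ 2 ≤ A * C * t ^ 2 * (t ^ 9 * (K * L) / W) := by
    refine (hAC.trans h4).trans (le_of_eq ?_)
    field_simp
  have h6 : 1 ≤ t ^ 9 * (K * L) / W := by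
    have : 0 < A * C * t ^ 2 := by positivity
    nlinarith
  rw [le_div_iff₀ hW] at h6
  have h7 : t ^ 9 ≤ t := pow_le_of_le_one ht.le ht1 (by norm_num)
  have := mul_le_mul_of_nonneg_right h7 (mul_pos hK' hL').le
  linarith

theorem numMessages_pos {R : ℝ} (hR : 0 ≤ R) : 0 < numMessages R :=
  Nat.floor_pos.2 (Real.one_le_rpow one_le_two hR)

theorem numMessages_le (R : ℝ) : (numMessages R : ℝ) ≤ (2 : ℝ) ^ R :=
  Nat.floor_le (Real.rpow_nonneg zero_le_two R)

theorem two_rpow_neg_mul_logb_one_div {t : ℝ} (ht : 0 < t) (k : ℕ) :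
    (2 : ℝ) ^ (-((k : ℝ) * Real.logb 2 (1 / t))) = t ^ k := by
  rw [one_div, Real.logb_inv, mul_neg, neg_neg, mul_comm, Real.rpow_mul zero_le_two,
    Real.rpow_logb two_pos (by norm_num) ht, Real.rpow_natCast]

/-! ### Construction of the code -/

theorem trace_one_sub_mul_le_of_hayashi_nagaoka {b ι : Type*} [Fintype b] [DecidableEq b]
    [Fintype ι] [DecidableEq ι] {Γ : ι → Matrix b b ℂ} {T σ : Matrix b b ℂ} {δ : ℝ} {i : ι}
    (hσ : 0 ≤ σ) (hσ1 : σ.trace = 1)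
    (h : 1 - T ≤ 2 • (1 - Γ i) + 4 • (∑ j ∈ Finset.univ.erase i, Γ j + (δ : ℂ) • 1)) :
    ((1 - T) * σ).trace.re ≤ (2 * (1 - (Γ i * σ).trace.re) + 4 * δ)
      + ∑ j ∈ Finset.univ.erase i, 4 * (Γ j * σ).trace.re := by
  refine (trace_mul_re_mono h hσ).trans (le_of_eq ?_)
  simp only [add_mul, sub_mul, smul_mul_assoc, one_mul, Finset.sum_mul, Matrix.trace_add,
    Matrix.trace_smul, Matrix.trace_sub, Matrix.trace_sum, hσ1, ← Finset.mul_sum]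
  simp
  ring

theorem Channel.state_nonneg {𝒳 b c : Type*} [Fintype b] [Fintype c] (N : Channel 𝒳 b c) (x : 𝒳) :
    0 ≤ N.state x :=
  Matrix.nonneg_iff_posSemidef.2 (N.isDensityMatrix x).posSemidef

section Codes

variable {𝒳 b c : Type*} [Fintype b] [Fintype c] [DecidableEq b] [DecidableEq c]

theorem Channel.error_nonneg (N : Channel 𝒳 b c) (x : 𝒳) {P : Matrix b b ℂ} {Q : Matrix c c ℂ}
    (hP0 : 0 ≤ P) (hP : P ≤ 1) (hQ : Q ≤ 1) : 0 ≤ ((1 - P ⊗ₖ Q) * N.state x).trace.re :=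
  trace_mul_re_nonneg (sub_nonneg.2 (kronecker_le_one hP0 hP hQ)) (N.state_nonneg x)

theorem Channel.error_le_one (N : Channel 𝒳 b c) (x : 𝒳) {P : Matrix b b ℂ} {Q : Matrix c c ℂ}
    (hP0 : 0 ≤ P) (hQ0 : 0 ≤ Q) : ((1 - P ⊗ₖ Q) * N.state x).trace.re ≤ 1 := by
  have := trace_mul_re_mono (sub_le_self 1 (kronecker_nonneg hP0 hQ0)) (N.state_nonneg x)
  rwa [one_mul, (N.isDensityMatrix x).trace_eq_one, Complex.one_re] at this

/-- An error bound of at least `1` is met by any constant encoder with any decoders. -/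
theorem nonempty_code_of_one_le (N : Channel 𝒳 b c) {R₁ R₂ ε : ℝ} (hR₁ : 0 ≤ R₁) (hR₂ : 0 ≤ R₂)
    (x : 𝒳) (hε : 1 ≤ ε) : Nonempty (Code N R₁ R₂ ε) := by
  have hM₁ := numMessages_pos hR₁
  have hM₂ := numMessages_pos hR₂
  have : Nonempty (Fin (numMessages R₁)) := ⟨⟨0, hM₁⟩⟩
  have : Nonempty (Fin (numMessages R₂)) := ⟨⟨0, hM₂⟩⟩
  obtain ⟨T₁, hT₁, -⟩ := exists_povm_hayashi_nagaoka (n := b) (M := Fin (numMessages R₁))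
    (κ := Unit) (fun _ => 0) (fun _ => le_rfl) (fun _ => zero_le_one) one_pos
  obtain ⟨T₂, hT₂, -⟩ := exists_povm_hayashi_nagaoka (n := c) (M := Fin (numMessages R₂))
    (κ := Unit) (fun _ => 0) (fun _ => le_rfl) (fun _ => zero_le_one) one_pos
  refine ⟨⟨fun _ => x, T₁, T₂, hT₁, hT₂, ?_⟩⟩
  have h1 : (0 : ℝ) < numMessages R₁ := by exact_mod_cast hM₁
  have h2 : (0 : ℝ) < numMessages R₂ := by exact_mod_cast hM₂
  rw [div_le_iff₀ (mul_pos h1 h2)]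
  refine (Finset.sum_le_card_nsmul _ _ 1 fun m _ => N.error_le_one x
    (Matrix.nonneg_iff_posSemidef.2 (hT₁.posSemidef m.1))
    (Matrix.nonneg_iff_posSemidef.2 (hT₂.posSemidef m.2))).trans ?_
  rw [Finset.card_univ, Fintype.card_prod, Fintype.card_fin, Fintype.card_fin, nsmul_eq_mul,
    Nat.cast_mul, mul_one]
  exact le_mul_of_one_le_left (mul_pos h1 h2).le hε

theorem sum_mul_two_mul_one_sub_add {W : Type*} [Fintype W] {p φ : W → ℝ} (hp1 : ∑ w, p w = 1)
    (d : ℝ) :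
    ∑ w, p w * (2 * (1 - φ w) + d) = 2 * (1 - ∑ w, p w * φ w) + d := by
  have : ∀ w, p w * (2 * (1 - φ w) + d) = p w * (2 + d) - 2 * (p w * φ w) := fun w => by ring
  simp only [this, Finset.sum_sub_distrib, ← Finset.sum_mul, ← Finset.mul_sum, hp1]
  ring

/-- The coding theorem for given blocks of tests, a given set `G` and given bin sizes. -/
theorem exists_code_of_tests {𝒰 𝒱 : Type*} [Fintype 𝒰] [Fintype 𝒱] [DecidableEq 𝒰]
    [DecidableEq 𝒱] (N : Channel 𝒳 b c) {p : 𝒰 × 𝒱 → ℝ} (hp : ∀ w, 0 ≤ p w)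
    (hp1 : ∑ w, p w = 1) (f : 𝒰 × 𝒱 → 𝒳) {R₁ R₂ ε₀ δ W x y : ℝ} (hR₁ : 0 ≤ R₁) (hR₂ : 0 ≤ R₂)
    (hδ : 0 < δ) {G : Finset (𝒰 × 𝒱)} (hG : 0 < ∑ w ∈ G, p w) (hW0 : 0 ≤ W)
    (hW : ∀ w ∈ G, p w / (marginalFst p w.1 * marginalSnd p w.2) ≤ W)
    {Γ : 𝒰 → Matrix b b ℂ} (hΓ0 : ∀ u, 0 ≤ Γ u) (hΓ1 : ∀ u, Γ u ≤ 1)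
    (hΓ : 1 - ε₀ ≤ ∑ w, p w * (Γ w.1 * traceRight (N.state (f w))).trace.re)
    (hΓx : ∑ u, marginalFst p u * ∑ w, p w * (Γ u * traceRight (N.state (f w))).trace.re ≤ x)
    {Λ : 𝒱 → Matrix c c ℂ} (hΛ0 : ∀ v, 0 ≤ Λ v) (hΛ1 : ∀ v, Λ v ≤ 1)
    (hΛ : 1 - ε₀ ≤ ∑ w, p w * (Λ w.2 * traceLeft (N.state (f w))).trace.re)
    (hΛy : ∑ v, marginalSnd p v * ∑ w, p w * (Λ v * traceLeft (N.state (f w))).trace.re ≤ y)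
    {K L : ℕ} (hK : 0 < K) (hL : 0 < L) {ε : ℝ}
    (hε : 2 / (∑ w ∈ G, p w) * (4 * ε₀ + 8 * δ + numMessages R₁ * K * (4 * x)
        + numMessages R₂ * L * (4 * y))
      + 4 / (∑ w ∈ G, p w) * (1 / K + 1 / L + W / (K * L)) ≤ ε) :
    Nonempty (Code N R₁ R₂ ε) := by
  have : Nonempty (Fin (numMessages R₁)) := ⟨⟨0, numMessages_pos hR₁⟩⟩
  have : Nonempty (Fin (numMessages R₂)) := ⟨⟨0, numMessages_pos hR₂⟩⟩
  have : Nonempty (Fin K) := ⟨⟨0, hK⟩⟩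
  have : Nonempty (Fin L) := ⟨⟨0, hL⟩⟩
  -- the decoders, for every codebook
  have hdecB := fun u : Fin (numMessages R₁) × Fin K → 𝒰 =>
    exists_povm_hayashi_nagaoka (fun i => Γ (u i)) (fun i => hΓ0 (u i)) (fun i => hΓ1 (u i)) hδ
  have hdecC := fun v : Fin (numMessages R₂) × Fin L → 𝒱 =>
    exists_povm_hayashi_nagaoka (fun j => Λ (v j)) (fun j => hΛ0 (v j)) (fun j => hΛ1 (v j)) hδ
  choose T hT hTle using hdecB
  choose S hS hSle using hdecC
  have hT0 : ∀ u m, 0 ≤ T u m := fun u m => Matrix.nonneg_iff_posSemidef.2 ((hT u).posSemidef m)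
  have hS0 : ∀ v m, 0 ≤ S v m := fun v m => Matrix.nonneg_iff_posSemidef.2 ((hS v).posSemidef m)
  have hB0 : ∀ w, 0 ≤ traceRight (N.state (f w)) := fun w => traceRight_nonneg (N.state_nonneg _)
  have hC0 : ∀ w, 0 ≤ traceLeft (N.state (f w)) := fun w => traceLeft_nonneg (N.state_nonneg _)
  have hB1 : ∀ w, (traceRight (N.state (f w))).trace = 1 := fun w => by
    rw [trace_traceRight, (N.isDensityMatrix _).trace_eq_one]
  have hC1 : ∀ w, (traceLeft (N.state (f w))).trace = 1 := fun w => by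
    rw [trace_traceLeft, (N.isDensityMatrix _).trace_eq_one]
  set φ : 𝒰 → 𝒰 → 𝒱 → ℝ := fun u' u v => (Γ u' * traceRight (N.state (f (u, v)))).trace.re
    with hφ
  set ψ : 𝒱 → 𝒰 → 𝒱 → ℝ := fun v' u v => (Λ v' * traceLeft (N.state (f (u, v)))).trace.re
    with hψ
  have hφ0 : ∀ u' u v, 0 ≤ φ u' u v := fun u' u v => trace_mul_re_nonneg (hΓ0 u') (hB0 _)
  have hψ0 : ∀ v' u v, 0 ≤ ψ v' u v := fun v' u v => trace_mul_re_nonneg (hΛ0 v') (hC0 _)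
  have hφ1 : ∀ u' u v, φ u' u v ≤ 1 := fun u' u v => by
    have := trace_mul_re_mono (hΓ1 u') (hB0 (u, v))
    rwa [one_mul, hB1, Complex.one_re] at this
  have hψ1 : ∀ v' u v, ψ v' u v ≤ 1 := fun v' u v => by
    have := trace_mul_re_mono (hΛ1 v') (hC0 (u, v))
    rwa [one_mul, hC1, Complex.one_re] at this
  have hx0 : 0 ≤ x := (Finset.sum_nonneg fun u _ => mul_nonneg (marginalFst_nonneg hp u)
    (Finset.sum_nonneg fun w _ => mul_nonneg (hp w) (hφ0 u w.1 w.2))).trans hΓx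
  have hy0 : 0 ≤ y := (Finset.sum_nonneg fun v _ => mul_nonneg (marginalSnd_nonneg hp v)
    (Finset.sum_nonneg fun w _ => mul_nonneg (hp w) (hψ0 v w.1 w.2))).trans hΛy
  have hratio : ∀ u v, truncatedRatio p G u v ≤ W := fun u v => by
    unfold truncatedRatio
    split_ifs with h
    exacts [hW _ h, hW0]
  have hg : ∑ u, marginalFst p u * ∑ v, marginalSnd p v * truncatedRatio p G u v
      = ∑ w ∈ G, p w := by
    simpa using sum_marginals_mul_truncatedRatio_mul (G := G) hp (fun _ _ => 1)
  let e : (Fin (numMessages R₁) × Fin K → 𝒰) → (Fin (numMessages R₂) × Fin L → 𝒱) →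
      Fin (numMessages R₁) × Fin K → Fin (numMessages R₂) × Fin L → ℝ :=
    fun u v i j => ((1 - T u i.1 ⊗ₖ S v j.1) * N.state (f (u i, v j))).trace.re
  have he0 : ∀ u v i j, 0 ≤ e u v i j := fun u v i j =>
    N.error_nonneg _ (hT0 u i.1) ((hT u).le_one _) ((hS v).le_one _)
  have he1 : ∀ u v i j, e u v i j ≤ 1 := fun u v i j => N.error_le_one _ (hT0 u i.1) (hS0 v j.1)
  have hle : ∀ u v i j, e u v i j
      ≤ ((2 * (1 - φ (u i) (u i) (v j)) + 4 * δ) + (2 * (1 - ψ (v j) (u i) (v j)) + 4 * δ))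
        + ∑ i' ∈ Finset.univ.erase i, 4 * φ (u i') (u i) (v j)
        + ∑ j' ∈ Finset.univ.erase j, 4 * ψ (v j') (u i) (v j) := fun u v i j => by
    refine (trace_one_sub_kronecker_mul_le ((hT u).le_one _) ((hS v).le_one _)
      (N.state_nonneg _)).trans ?_
    have h1 := trace_one_sub_mul_le_of_hayashi_nagaoka (Γ := fun i => Γ (u i)) (i := i)
      (hB0 (u i, v j)) (hB1 (u i, v j)) (hTle u i)
    have h2 := trace_one_sub_mul_le_of_hayashi_nagaoka (Γ := fun j => Λ (v j)) (i := j)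
      (hC0 (u i, v j)) (hC1 (u i, v j)) (hSle v j)
    exact (add_le_add h1 h2).trans (le_of_eq (by ring))
  have hH : ∑ u, marginalFst p u * ∑ v, marginalSnd p v * (truncatedRatio p G u v *
      ((2 * (1 - φ u u v) + 4 * δ) + (2 * (1 - ψ v u v) + 4 * δ))) ≤ 4 * ε₀ + 8 * δ := by
    refine (sum_truncatedRatio_mul_le hp fun u v => ?_).trans ?_
    · linarith [hφ1 u u v, hψ1 v u v]
    · simp only [mul_add (p _), Finset.sum_add_distrib]
      have h1 := sum_mul_two_mul_one_sub_add (φ := fun w : 𝒰 × 𝒱 => φ w.1 w.1 w.2) hp1 (4 * δ)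
      have h2 := sum_mul_two_mul_one_sub_add (φ := fun w : 𝒰 × 𝒱 => ψ w.2 w.1 w.2) hp1 (4 * δ)
      simp only [mul_add (p _), Finset.sum_add_distrib] at h1 h2
      linarith
  have hΦ : ∑ u, marginalFst p u * ∑ u', marginalFst p u' * ∑ v, marginalSnd p v *
      (truncatedRatio p G u v * (4 * φ u' u v)) ≤ 4 * x := by
    refine (sum_fst_interference_le (φ := fun u' u v => 4 * φ u' u v) hp
      fun u' u v => mul_nonneg zero_le_four (hφ0 u' u v)).trans
        (le_trans (le_of_eq ?_) (mul_le_mul_of_nonneg_left hΓx zero_le_four))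
    simp only [Finset.mul_sum, hφ]
    exact Finset.sum_congr rfl fun _ _ => Finset.sum_congr rfl fun _ _ => by ring
  have hΨ : ∑ v, marginalSnd p v * ∑ v', marginalSnd p v' * ∑ u, marginalFst p u *
      (truncatedRatio p G u v * (4 * ψ v' u v)) ≤ 4 * y := by
    refine (sum_snd_interference_le (ψ := fun v' u v => 4 * ψ v' u v) hp
      fun v' u v => mul_nonneg zero_le_four (hψ0 v' u v)).trans
        (le_trans (le_of_eq ?_) (mul_le_mul_of_nonneg_left hΛy zero_le_four))
    simp only [Finset.mul_sum, hψ]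
    exact Finset.sum_congr rfl fun _ _ => Finset.sum_congr rfl fun _ _ => by ring
  obtain ⟨u, v, k, huv⟩ := exists_codebook
    (h := fun u v => (2 * (1 - φ u u v) + 4 * δ) + (2 * (1 - ψ v u v) + 4 * δ))
    (φ := fun u' u v => 4 * φ u' u v) (ψ := fun v' u v => 4 * ψ v' u v)
    (marginalFst_nonneg hp) ((sum_marginalFst p).trans hp1)
    (marginalSnd_nonneg hp) ((sum_marginalSnd p).trans hp1)
    (truncatedRatio_nonneg hp) hratio (sum_marginalSnd_mul_truncatedRatio_le_one hp)
    (sum_marginalFst_mul_truncatedRatio_le_one hp) hG hg he0 he1 hle hH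
    (mul_nonneg zero_le_four hx0) hΦ (mul_nonneg zero_le_four hy0) hΨ
  simp only [Fintype.card_fin] at huv
  exact ⟨⟨fun m => f (u (m.1, (k m).1), v (m.2, (k m).2)), T u, S v, hT u, hS v, huv.trans hε⟩⟩

end Codes

end CQBroadcast

theorem theorem3 {𝒳 𝒰 𝒱 b c : Type*} [Fintype 𝒰] [Fintype 𝒱] [Fintype b] [Fintype c]
    [DecidableEq 𝒰] [DecidableEq 𝒱] [DecidableEq b] [DecidableEq c]
    (N : CQBroadcast.Channel 𝒳 b c)
    (p : 𝒰 × 𝒱 → ℝ) (hp : p ∈ stdSimplex ℝ (𝒰 × 𝒱)) (f : 𝒰 × 𝒱 → 𝒳)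
    (R₁ R₂ ε ε₀ εinf εt : ℝ)
    (hR₁ : 0 ≤ R₁) (hR₂ : 0 ≤ R₂)
    (hε₀ : 0 ≤ ε₀) (hε₀' : ε₀ < 1) (hεinf : 0 ≤ εinf) (hεinf' : εinf ≤ 1 / 4)
    (hεt : 0 < εt) (hε : 40 * εt + 16 * ε₀ ≤ ε)
    (h1 : (R₁ : EReal) ≤
      CQBroadcast.smoothMin ε₀ (CQBroadcast.marginalUB (CQBroadcast.stateUVBC N p f))
        - ((5 * Real.logb 2 (1 / εt) + 2 : ℝ) : EReal))
    (h2 : (R₂ : EReal) ≤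
      CQBroadcast.smoothMin ε₀ (CQBroadcast.marginalVC (CQBroadcast.stateUVBC N p f))
        - ((5 * Real.logb 2 (1 / εt) + 2 : ℝ) : EReal))
    (h3 : ((R₁ + R₂ : ℝ) : EReal) ≤
      CQBroadcast.smoothMin ε₀ (CQBroadcast.marginalUB (CQBroadcast.stateUVBC N p f))
        + CQBroadcast.smoothMin ε₀ (CQBroadcast.marginalVC (CQBroadcast.stateUVBC N p f))
        - CQBroadcast.smoothMax εinf p
        - ((11 * Real.logb 2 (1 / εt) + 5 : ℝ) : EReal)) :
    Nonempty (CQBroadcast.Code N R₁ R₂ ε) := by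
  open CQBroadcast in
  obtain ⟨hp0, hp1⟩ := hp
  obtain ⟨w₀, -, -⟩ : ∃ w ∈ Finset.univ, p w ≠ 0 :=
    Finset.exists_ne_zero_of_sum_ne_zero (hp1.trans_ne one_ne_zero)
  -- below error `1`, the hypothesis on `ε` forces `εt ≤ 1`, as `exists_bin_sizes` needs
  rcases le_or_gt 1 ε with hε1 | hε1
  · exact nonempty_code_of_one_le N hR₁ hR₂ (f w₀) hε1
  have ht1 : εt ≤ 1 := by linarith
  obtain ⟨a, a', s, ha, ha', hs, hr1, hr2, hr3⟩ := exists_real_rates h1 h2 h3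
  obtain ⟨Γ, hΓ0, hΓ1, hΓ, hΓx⟩ := exists_tests_fst N p f ha
  obtain ⟨Λ, hΛ0, hΛ1, hΛ, hΛy⟩ := exists_tests_snd N p f ha'
  obtain ⟨G, hG, hGs⟩ := exists_finset_of_smoothMax_lt hs
  have two0 : (0 : ℝ) < 2 := two_pos
  have hpow5 := two_rpow_neg_mul_logb_one_div hεt 5
  have hpow11 := two_rpow_neg_mul_logb_one_div hεt 11
  push_cast at hpow5 hpow11
  have rate : ∀ {R z : ℝ}, R ≤ z - (5 * Real.logb 2 (1 / εt) + 2) + 1 →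
      (2 : ℝ) ^ R ≤ 2 ^ z * εt ^ 5 / 2 := fun {R z} h => by
    calc (2 : ℝ) ^ R ≤ 2 ^ (z + -(5 * Real.logb 2 (1 / εt)) - 1) :=
          Real.rpow_le_rpow_of_exponent_le one_le_two (by linarith)
      _ = _ := by rw [Real.rpow_sub two0, Real.rpow_add two0, hpow5, Real.rpow_one]
  have hsum : (2 : ℝ) ^ R₁ * 2 ^ R₂ ≤ 2 ^ a * 2 ^ a' / 2 ^ s * εt ^ 11 / 4 := by
    calc (2 : ℝ) ^ R₁ * 2 ^ R₂ = 2 ^ (R₁ + R₂) := (Real.rpow_add two0 _ _).symm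
      _ ≤ 2 ^ (a + a' - s + -(11 * Real.logb 2 (1 / εt)) - 2) :=
          Real.rpow_le_rpow_of_exponent_le one_le_two (by linarith)
      _ = _ := by
        rw [Real.rpow_sub two0, Real.rpow_add two0, hpow11, Real.rpow_sub two0,
          Real.rpow_add two0]
        norm_num
  have hM₁ : (0 : ℝ) < numMessages R₁ := by exact_mod_cast numMessages_pos hR₁
  have hM₂ : (0 : ℝ) < numMessages R₂ := by exact_mod_cast numMessages_pos hR₂
  have hA : (0 : ℝ) < 2 ^ a := Real.rpow_pos_of_pos two0 a
  have hA' : (0 : ℝ) < 2 ^ a' := Real.rpow_pos_of_pos two0 a'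
  have hW : (0 : ℝ) < 2 ^ s := Real.rpow_pos_of_pos two0 s
  obtain ⟨K, L, hK, hL, hKa, hLa, hKt, hLt, hKL⟩ := exists_bin_sizes hM₁ hM₂ hA hA' hW hεt ht1
    ((numMessages_le R₁).trans (rate hr1)) ((numMessages_le R₂).trans (rate hr2))
    ((mul_le_mul (numMessages_le R₁) (numMessages_le R₂) hM₂.le
      (Real.rpow_nonneg two0.le _)).trans hsum)
  have hg : (3 : ℝ) / 4 ≤ ∑ w ∈ G, p w := by linarith
  have hg0 : 0 < ∑ w ∈ G, p w := by linarith
  refine exists_code_of_tests N hp0 hp1 f hR₁ hR₂ (δ := εt / 8) (by positivity) hg0 hW.le hGs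
    hΓ0 hΓ1 hΓ.le hΓx hΛ0 hΛ1 hΛ.le hΛy hK hL ?_
  rw [Real.rpow_neg two0.le, Real.rpow_neg two0.le]
  have hx : (numMessages R₁ : ℝ) * K * (4 * (2 ^ a)⁻¹) ≤ 4 * εt := by
    rw [← div_eq_mul_inv, ← mul_div_assoc, div_le_iff₀ hA]
    linarith
  have hy : (numMessages R₂ : ℝ) * L * (4 * (2 ^ a')⁻¹) ≤ 4 * εt := by
    rw [← div_eq_mul_inv, ← mul_div_assoc, div_le_iff₀ hA']
    linarith
  have hx0 : 0 ≤ (numMessages R₁ : ℝ) * K * (4 * (2 ^ a)⁻¹) := by positivity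
  have hy0 : 0 ≤ (numMessages R₂ : ℝ) * L * (4 * (2 ^ a')⁻¹) := by positivity
  generalize ∑ w ∈ G, p w = g at *
  -- with `δ = εt / 8` and `g ≥ 3 / 4` the error is at most
  -- `8 / 3 * (4 ε₀ + εt + 4 εt + 4 εt) + 16 / 3 * 3 εt = 32 / 3 * ε₀ + 40 εt`
  have e1 : 2 / g ≤ 8 / 3 := by rw [div_le_div_iff₀ hg0 (by norm_num)]; linarith
  have e2 : 4 / g ≤ 16 / 3 := by rw [div_le_div_iff₀ hg0 (by norm_num)]; linarith
  have e3 := mul_le_mul e1 (show 4 * ε₀ + 8 * (εt / 8)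
      + numMessages R₁ * K * (4 * (2 ^ a)⁻¹) + numMessages R₂ * L * (4 * (2 ^ a')⁻¹)
      ≤ 4 * ε₀ + 9 * εt by linarith) (by positivity) (by norm_num)
  have e4 := mul_le_mul e2 (show 1 / (K : ℝ) + 1 / L + 2 ^ s / (K * L) ≤ 3 * εt by linarith)
    (by positivity) (by norm_num)
  linarith
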